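/- Let $\mathcal Q$ be a small quantaloid (a small category enriched in complete lattices and supremum-preserving maps). A $\mathcal Q$-category $\mathbb A$ is a set of objects $a$ with types $ta\in\mathcal Q$ and hom-arrows $\mathbb A(a',a)\colon ta\to ta'$ such that $\mathbb A(a'',a')\circ\mathbb A(a',a)\le\mathbb A(a'',a)$ and $1_{ta}\le\mathbb A(a,a)$; functors are type-preserving maps with $\mathbb A(a',a)\le\mathbb B(Fa',Fa)$, and $F\le G$ means $1_{ta}\le\mathbb B(Fa,Ga)$ for all $a$. A distributor $\Phi\colon\mathbb A\to\mathbb B$ consists of arrows $\Phi(b,a)\colon ta\to tb$ with $\mathbb B(b,b')\circ\Phi(b',a)\le\Phi(b,a)$ and $\Phi(b,a')\circ\mathbb A(a',a)\le\Phi(b,a)$; distributors are ordered elementwise, compose by $(\Psi\otimes\Phi)(c,a)=\bigvee_b\Psi(c,b)\circ\Phi(b,a)$, and have liftings $[\Phi,-]$ right adjoint to $\Phi\otimes-$ and extensions $\{\Phi,-\}$ right adjoint to $-\otimes\Phi$. The functor $K$ is the colimit $\mathrm{colim}(\Phi,F)$ when $\mathbb C(K-,-)=[\Phi,\mathbb C(F-,-)]$;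 $\mathbb C$ is cocomplete when all such colimits exist, and a functor is cocontinuous when it preserves those that exist. Write $\mathcal P\mathbb C$ for the (cocomplete) $\mathcal Q$-category of presheaves $\phi\colon *_X\to\mathbb C$, that is, distributors from the one-object $\mathcal Q$-categories $*_X$ with hom-arrow $1_X$, with hom-arrows $\mathcal P\mathbb C(\psi,\phi)=[\psi,\phi]$, and $Y_{\mathbb C}\colon\mathbb C\to\mathcal P\mathbb C$, $c\mapsto\mathbb C(-,c)$, for the Yoneda embedding. For $\mathbb A$ cocomplete, put $\sup_{\mathbb A}(\phi)=\mathrm{colim}(\phi,1_{\mathbb A})$ and $\Theta_{\mathbb A}=\{\mathbb A(-,\sup_{\mathbb A}-),\mathcal P\mathbb A(Y_{\mathbb A}-,-)\}$. An object $a$ is totally compact when $1_{ta}\le\Theta_{\mathbb A}(a,a)$; $i_{\mathbb A}\colon\mathbb A_{\sf c}\to\mathbb A$ is the full embedding of the totally compact objects; $\mathbb A$ is totally algebraic when the left Kan extension of $i_{\mathbb A}$ along itself is isomorphic to $1_{\mathbb A}$. A $\mathcal Q$-category $\mathbb C$ is Cauchy complete when every left adjoint distributor into $\mathbb C$ is of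 the form $\mathbb C(-,F-)$ for a functor $F$. Let ${\sf Cat}(\mathcal Q)$ be the locally ordered 2-category of $\mathcal Q$-categories and functors, and let ${\sf Map}({\sf Cocont}(\mathcal Q))$ be that of cocomplete $\mathcal Q$-categories and cocontinuous functors that have a cocontinuous right adjoint. **Theorem A7.** There is a biadjunction with left biadjoint the 2-functor $$\mathcal P\colon{\sf Cat}(\mathcal Q)\to{\sf Map}({\sf Cocont}(\mathcal Q)),\qquad (F\colon\mathbb C\to\mathbb D)\mapsto(\mathbb D(-,F-)\otimes-\colon\mathcal P\mathbb C\to\mathcal P\mathbb D),$$ and right biadjoint the 2-functor $$(-)_{\sf c}\colon{\sf Map}({\sf Cocont}(\mathcal Q))\to{\sf Cat}(\mathcal Q),\qquad (F\colon\mathbb A\to\mathbb B)\mapsto(F\colon\mathbb A_{\sf c}\to\mathbb B_{\sf c}).$$ Its unit is the corestricted Yoneda embedding $\overline Y_{\mathbb C}\colon\mathbb C\to(\mathcal P\mathbb C)_{\sf c}$, $c\mapsto\mathbb C(-,c)$, and its counit is $R_{\mathbb A}\colon\mathcal P(\mathbb A_{\sf c})\to\mathbb A$, $\phi\mapsto\mathrm{colim}(\phi,i_{\mathbb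 A})$; for every $\mathcal Q$-category $\mathbb C$ and every cocomplete $\mathbb A$, the assignment $F\mapsto R_{\mathbb A}\circ\mathcal P F$ is an equivalence of ordered sets from ${\sf Cat}(\mathcal Q)(\mathbb C,\mathbb A_{\sf c})$ to ${\sf Map}({\sf Cocont}(\mathcal Q))(\mathcal P\mathbb C,\mathbb A)$. Moreover, $\overline Y_{\mathbb C}$ is an equivalence if and only if $\mathbb C$ is Cauchy complete, and $R_{\mathbb A}$ is an equivalence if and only if $\mathbb A$ is totally algebraic. The 2-functor $\mathcal P$ sends Cauchy complete $\mathcal Q$-categories to totally algebraic ones, $(-)_{\sf c}$ sends totally algebraic cocomplete $\mathcal Q$-categories to Cauchy complete ones, and the biadjunction restricts to a biequivalence $\mathcal P\colon{\sf Cat}_{\sf cc}(\mathcal Q)\to{\sf Map}({\sf Cocont}_{\sf ta}(\mathcal Q))$ between the full sub-2-categories on these objects, with inverse biequivalence $(-)_{\sf c}$, the restricted unit and counit being equivalences. -/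

import Mathlib

universe u w₁ v₁ u₁ w₂ v₂ u₂

open CategoryTheory Bicategory

/-! ### Quantaloids -/

/-- A small quantaloid: a small category enriched in complete lattices and supremum-preserving maps.
Mathlib's `f ≫ g` is the composite written `g ∘ f` in the usual order. -/
class Quantaloid (Q : Type u) extends Category.{u} Q where
  homLattice : ∀ X Y : Q, CompleteLattice (X ⟶ Y)
  sSup_comp : ∀ {X Y Z : Q} (S : Set (X ⟶ Y)) (g : Y ⟶ Z), sSup S ≫ g = ⨆ f ∈ S, f ≫ g
  comp_sSup : ∀ {X Y Z : Q} (f : X ⟶ Y) (S : Set (Y ⟶ Z)), f ≫ sSup S = ⨆ g ∈ S, f ≫ g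

attribute [reducible, instance] Quantaloid.homLattice

namespace Quantaloid

variable {Q : Type u} [Quantaloid Q] {X Y Z : Q}

theorem iSup_comp {ι : Sort*} (f : ι → (X ⟶ Y)) (g : Y ⟶ Z) : (⨆ i, f i) ≫ g = ⨆ i, f i ≫ g := by
  rw [iSup, sSup_comp, iSup_range]

theorem comp_iSup {ι : Sort*} (f : X ⟶ Y) (g : ι → (Y ⟶ Z)) : f ≫ (⨆ i, g i) = ⨆ i, f ≫ g i := by
  rw [iSup, comp_sSup, iSup_range]

theorem comp_le_comp {f f' : X ⟶ Y} {g g' : Y ⟶ Z} (hf : f ≤ f') (hg : g ≤ g') :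
    f ≫ g ≤ f' ≫ g' := by
  have h1 : f ≫ g ≤ f' ≫ g := by
    have h := sSup_comp {f, f'} g
    rw [sSup_pair, sup_eq_right.mpr hf] at h
    rw [h]
    exact le_biSup (fun k => k ≫ g) (Set.mem_insert f {f'})
  have h2 : f' ≫ g ≤ f' ≫ g' := by
    have h := comp_sSup f' {g, g'}
    rw [sSup_pair, sup_eq_right.mpr hg] at h
    rw [h]
    exact le_biSup (fun k => f' ≫ k) (Set.mem_insert g {g'})
  exact h1.trans h2

/-- The lifting `[f, g]` of `g` through `f`: the largest `h` with `f ∘ h ≤ g`. -/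
def lift (f : X ⟶ Y) (g : Z ⟶ Y) : Z ⟶ X := sSup {h | h ≫ f ≤ g}

/-- The extension `{f, g}` of `g` through `f`: the largest `h` with `h ∘ f ≤ g`. -/
def ext (f : X ⟶ Y) (g : X ⟶ Z) : Y ⟶ Z := sSup {h | f ≫ h ≤ g}

theorem le_lift_iff {f : X ⟶ Y} {g : Z ⟶ Y} {h : Z ⟶ X} : h ≤ lift f g ↔ h ≫ f ≤ g := by
  constructor
  · intro hh
    refine (comp_le_comp hh le_rfl).trans ?_
    rw [lift, sSup_comp]
    exact iSup₂_le fun k hk => hk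
  · exact fun hh => le_sSup hh

theorem le_ext_iff {f : X ⟶ Y} {g : X ⟶ Z} {h : Y ⟶ Z} : h ≤ ext f g ↔ f ≫ h ≤ g := by
  constructor
  · intro hh
    refine (comp_le_comp le_rfl hh).trans ?_
    rw [ext, comp_sSup]
    exact iSup₂_le fun k hk => hk
  · exact fun hh => le_sSup hh

end Quantaloid

open Quantaloid

/-! ### Categories, functors and distributors enriched in a quantaloid -/

/-- A (small) `Q`-category. The set of objects with its type function `t` is given as the family
of its fibres: `Obj X` is the set of objects of type `X`. -/
structure QCat (Q : Type u) [Quantaloid Q] where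
  Obj : Q → Type u
  /-- `hom a' a` is the hom-arrow `𝔸(a', a) : ta ⟶ ta'`. -/
  hom : ∀ {X Y : Q}, Obj Y → Obj X → (X ⟶ Y)
  comp_le : ∀ {X Y Z : Q} (a'' : Obj Z) (a' : Obj Y) (a : Obj X),
    hom a' a ≫ hom a'' a' ≤ hom a'' a
  id_le : ∀ {X : Q} (a : Obj X), 𝟙 X ≤ hom a a

/-- A functor between `Q`-categories: a type-preserving map of objects with
`𝔸(a', a) ≤ 𝔹(Fa', Fa)`. -/
structure QFunctor {Q : Type u} [Quantaloid Q] (A B : QCat Q) where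
  map : ∀ {X : Q}, A.Obj X → B.Obj X
  hom_le : ∀ {X Y : Q} (a' : A.Obj Y) (a : A.Obj X), A.hom a' a ≤ B.hom (map a') (map a)

/-- A distributor `Φ : 𝔸 ⇸ 𝔹` with elements `Φ(b, a) : ta ⟶ tb`. -/
structure Distributor {Q : Type u} [Quantaloid Q] (A B : QCat Q) where
  app : ∀ {X Y : Q}, B.Obj Y → A.Obj X → (X ⟶ Y)
  left_le : ∀ {X Y Z : Q} (b : B.Obj Z) (b' : B.Obj Y) (a : A.Obj X),
    app b' a ≫ B.hom b b' ≤ app b a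
  right_le : ∀ {X Y Z : Q} (b : B.Obj Z) (a' : A.Obj Y) (a : A.Obj X),
    A.hom a' a ≫ app b a' ≤ app b a

section Basic

variable {Q : Type u} [Quantaloid Q] {A B C D : QCat Q} {X Y Z : Q}

/-- The underlying order on the objects of a given type: `a ≤ a'` when `1 ≤ 𝔸(a, a')`. -/
def QCat.Le (A : QCat Q) (a a' : A.Obj X) : Prop := 𝟙 X ≤ A.hom a a'

theorem QCat.Le.trans {a b c : A.Obj X} (h : A.Le a b) (k : A.Le b c) : A.Le a c := by
  have h' := comp_le_comp k h
  rw [Category.id_comp] at h'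
  exact h'.trans (A.comp_le a b c)

theorem QCat.Le.hom_le_hom {b b' : A.Obj X} (h : A.Le b b') (a : A.Obj Y) :
    A.hom a b ≤ A.hom a b' := by
  have h' := (comp_le_comp h (le_refl (A.hom a b))).trans (A.comp_le a b b')
  rwa [Category.id_comp] at h'

theorem QCat.Le.hom_le_hom' {b b' : A.Obj X} (h : A.Le b b') (a : A.Obj Y) :
    A.hom b' a ≤ A.hom b a := by
  have h' := (comp_le_comp (le_refl (A.hom b' a)) h).trans (A.comp_le b b' a)
  rwa [Category.comp_id] at h'

namespace QFunctor

@[ext]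
theorem ext' {F G : QFunctor A B} (h : ∀ (X : Q) (a : A.Obj X), F.map a = G.map a) : F = G := by
  obtain ⟨f, hf⟩ := F
  obtain ⟨g, hg⟩ := G
  have : @f = @g := by
    funext X a
    exact h X a
  subst this
  rfl

/-- The identity functor. -/
def id (A : QCat Q) : QFunctor A A := ⟨fun a => a, fun _ _ => le_rfl⟩

/-- The composite `G ∘ F`. -/
def comp (F : QFunctor A B) (G : QFunctor B C) : QFunctor A C :=
  ⟨fun a => G.map (F.map a), fun a' a => (F.hom_le a' a).trans (G.hom_le _ _)⟩

/-- Functors are ordered pointwise by the underlying order of the codomain. -/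
instance : Preorder (QFunctor A B) where
  le F G := ∀ (X : Q) (a : A.Obj X), B.Le (F.map a) (G.map a)
  le_refl F _ a := B.id_le (F.map a)
  le_trans _ _ _ h k X a := (h X a).trans (k X a)

theorem comp_mono {F F' : QFunctor A B} {G G' : QFunctor B C} (h : F ≤ F') (k : G ≤ G') :
    F.comp G ≤ F'.comp G' := fun X a =>
  QCat.Le.trans (le_trans (h X a) (G.hom_le _ _)) (k X (F'.map a))

/-- `F ⊣ G` in the locally ordered category of `Q`-categories: `1 ≤ G ∘ F` and `F ∘ G ≤ 1`. -/
def IsAdjoint (F : QFunctor A B) (G : QFunctor B A) : Prop :=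
  id A ≤ F.comp G ∧ G.comp F ≤ id B

end QFunctor

/-- `Cat(Q)`: the locally ordered 2-category of `Q`-categories and functors. There is a (unique)
2-cell `F ⟶ G` precisely when `F ≤ G`. -/
instance QCat.bicategory : Bicategory.{u, u} (QCat Q) where
  Hom A B := QFunctor A B
  id A := QFunctor.id A
  comp F G := F.comp G
  homCategory _ _ := Preorder.smallCategory _
  whiskerLeft _ _ _ θ := homOfLE (QFunctor.comp_mono le_rfl (CategoryTheory.leOfHom θ))
  whiskerRight θ _ := homOfLE (QFunctor.comp_mono (CategoryTheory.leOfHom θ) le_rfl)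
  associator _ _ _ := Iso.refl _
  leftUnitor _ := Iso.refl _
  rightUnitor _ := Iso.refl _

instance QCat.isThin (A B : QCat Q) : Quiver.IsThin (A ⟶ B) :=
  fun F G => inferInstanceAs (Subsingleton (ULift (PLift ((show QFunctor A B from F) ≤ G))))

/-- The 2-cell given by an inequality of functors. -/
def QCat.homOfLe {F G : A ⟶ B}
    (h : ∀ (X : Q) (a : A.Obj X), B.Le (QFunctor.map F a) (QFunctor.map G a)) : F ⟶ G := ⟨⟨h⟩⟩

theorem QCat.leOfHom {F G : A ⟶ B} (θ : F ⟶ G) (X : Q) (a : A.Obj X) :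
    B.Le (QFunctor.map F a) (QFunctor.map G a) := θ.down.down X a

instance QCat.strict : Bicategory.Strict (QCat Q) where
  id_comp _ := rfl
  comp_id _ := rfl
  assoc _ _ _ := rfl
  leftUnitor_eqToIso _ := rfl
  rightUnitor_eqToIso _ := rfl
  associator_eqToIso _ _ _ := rfl

namespace Distributor

@[ext]
theorem ext' {Φ Ψ : Distributor A B}
    (h : ∀ (X Y : Q) (b : B.Obj Y) (a : A.Obj X), Φ.app b a = Ψ.app b a) : Φ = Ψ := by
  obtain ⟨f, hf, hf'⟩ := Φ
  obtain ⟨g, hg, hg'⟩ := Ψ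
  have : @f = @g := by
    funext X Y b a
    exact h X Y b a
  subst this
  rfl

/-- Distributors are ordered elementwise. -/
instance : PartialOrder (Distributor A B) where
  le Φ Ψ := ∀ (X Y : Q) (b : B.Obj Y) (a : A.Obj X), Φ.app b a ≤ Ψ.app b a
  le_refl _ _ _ _ _ := le_rfl
  le_trans _ _ _ h k X Y b a := (h X Y b a).trans (k X Y b a)
  le_antisymm _ _ h k := ext' fun X Y b a => le_antisymm (h X Y b a) (k X Y b a)

/-- The identity distributor on `𝔸` is `𝔸` itself. -/
def id (A : QCat Q) : Distributor A A :=
  ⟨fun a' a => A.hom a' a, fun _ _ _ => A.comp_le _ _ _, fun _ _ _ => A.comp_le _ _ _⟩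

/-- The composite `Ψ ⊗ Φ`, with elements `⋁_b Ψ(c, b) ∘ Φ(b, a)`. -/
def comp (Φ : Distributor A B) (Ψ : Distributor B C) : Distributor A C where
  app c a := ⨆ (Y : Q) (b : B.Obj Y), Φ.app b a ≫ Ψ.app c b
  left_le c c' a := by
    simp only [iSup_comp, Category.assoc]
    exact iSup₂_mono fun Y b => comp_le_comp le_rfl (Ψ.left_le _ _ _)
  right_le c a' a := by
    simp only [comp_iSup, ← Category.assoc]
    exact iSup₂_mono fun Y b => comp_le_comp (Φ.right_le _ _ _) le_rfl

/-- The lifting `[Φ, Ψ]` of `Ψ` through `Φ`, with elements `⋀_b [Φ(b, a), Ψ(b, c)]`. -/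
def lift (Φ : Distributor A B) (Ψ : Distributor C B) : Distributor C A where
  app a c := ⨅ (Y : Q) (b : B.Obj Y), Quantaloid.lift (Φ.app b a) (Ψ.app b c)
  left_le a a' c := by
    refine le_iInf₂ fun Y b => le_lift_iff.mpr ?_
    rw [Category.assoc]
    exact (comp_le_comp le_rfl (Φ.right_le _ _ _)).trans (le_lift_iff.mp (iInf₂_le Y b))
  right_le a c' c := by
    refine le_iInf₂ fun Y b => le_lift_iff.mpr ?_
    rw [Category.assoc]
    exact (comp_le_comp le_rfl (le_lift_iff.mp (iInf₂_le Y b))).trans (Ψ.right_le _ _ _)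

/-- The extension `{Φ, Ψ}` of `Ψ` through `Φ`, with elements `⋀_a {Φ(b, a), Ψ(c, a)}`. -/
def ext (Φ : Distributor A B) (Ψ : Distributor A C) : Distributor B C where
  app c b := ⨅ (X : Q) (a : A.Obj X), Quantaloid.ext (Φ.app b a) (Ψ.app c a)
  left_le c c' b := by
    refine le_iInf₂ fun X a => le_ext_iff.mpr ?_
    rw [← Category.assoc]
    exact (comp_le_comp (le_ext_iff.mp (iInf₂_le X a)) le_rfl).trans (Ψ.left_le _ _ _)
  right_le c b' b := by
    refine le_iInf₂ fun X a => le_ext_iff.mpr ?_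
    rw [← Category.assoc]
    exact (comp_le_comp (Φ.left_le _ _ _) le_rfl).trans (le_ext_iff.mp (iInf₂_le X a))

theorem le_lift_app {Φ : Distributor A B} {Ψ : Distributor C B} {a : A.Obj X} {c : C.Obj Y}
    {h : Y ⟶ X} :
    h ≤ (lift Φ Ψ).app a c ↔ ∀ (Z : Q) (b : B.Obj Z), h ≫ Φ.app b a ≤ Ψ.app b c := by
  simp only [lift, le_iInf_iff, le_lift_iff]

theorem le_ext_app {Φ : Distributor A B} {Ψ : Distributor A C} {b : B.Obj X} {c : C.Obj Y}
    {h : X ⟶ Y} :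
    h ≤ (ext Φ Ψ).app c b ↔ ∀ (Z : Q) (a : A.Obj Z), Φ.app b a ≫ h ≤ Ψ.app c a := by
  simp only [ext, le_iInf_iff, le_ext_iff]

/-- The defining property of liftings: `Φ ⊗ -` is left adjoint to `[Φ, -]`. -/
theorem le_lift_iff {Φ : Distributor A B} {Ψ : Distributor C B} {Θ : Distributor C A} :
    Θ ≤ lift Φ Ψ ↔ Θ.comp Φ ≤ Ψ := by
  constructor
  · exact fun h X Y b c => iSup₂_le fun Z a => le_lift_app.mp (h X Z a c) Y b
  · exact fun h X Y a c => le_lift_app.mpr fun Z b =>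
      (le_iSup₂_of_le Y a le_rfl).trans (h X Z b c)

/-- The defining property of extensions: `- ⊗ Φ` is left adjoint to `{Φ, -}`. -/
theorem le_ext_iff {Φ : Distributor A B} {Ψ : Distributor A C} {Θ : Distributor B C} :
    Θ ≤ ext Φ Ψ ↔ Φ.comp Θ ≤ Ψ := by
  constructor
  · exact fun h X Y c a => iSup₂_le fun Z b => le_ext_app.mp (h Z Y c b) X a
  · exact fun h X Y c b => le_ext_app.mpr fun Z a =>
      (le_iSup₂_of_le X b le_rfl).trans (h Z Y c a)

theorem id_comp (Φ : Distributor A B) : (id A).comp Φ = Φ := by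
  ext X Y b a
  apply le_antisymm
  · exact iSup₂_le fun Z a' => Φ.right_le _ _ _
  · refine le_iSup₂_of_le X a ?_
    have h := comp_le_comp (A.id_le a) (le_refl (Φ.app b a))
    rwa [Category.id_comp] at h

theorem comp_id (Φ : Distributor A B) : Φ.comp (id B) = Φ := by
  ext X Y b a
  apply le_antisymm
  · exact iSup₂_le fun Z b' => Φ.left_le _ _ _
  · refine le_iSup₂_of_le Y b ?_
    have h := comp_le_comp (le_refl (Φ.app b a)) (B.id_le b)
    rwa [Category.comp_id] at h

theorem comp_assoc (Φ : Distributor A B) (Ψ : Distributor B C) (Θ : Distributor C D) :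
    (Φ.comp Ψ).comp Θ = Φ.comp (Ψ.comp Θ) := by
  ext X Y d a
  simp only [comp, iSup_comp, comp_iSup, Category.assoc]
  apply le_antisymm
  · exact iSup₂_le fun Z c => iSup₂_le fun W b => le_iSup₂_of_le W b (le_iSup₂_of_le Z c le_rfl)
  · exact iSup₂_le fun W b => iSup₂_le fun Z c => le_iSup₂_of_le Z c (le_iSup₂_of_le W b le_rfl)

theorem comp_mono {Φ Φ' : Distributor A B} {Ψ Ψ' : Distributor B C} (h : Φ ≤ Φ') (k : Ψ ≤ Ψ') :
    Φ.comp Ψ ≤ Φ'.comp Ψ' := fun _ _ _ _ =>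
  iSup₂_mono fun _ _ => comp_le_comp (h _ _ _ _) (k _ _ _ _)

/-- A distributor is Cauchy when it is a left adjoint: there is `Ψ` with `1 ≤ Ψ ⊗ Φ` and
`Φ ⊗ Ψ ≤ 1`. -/
def IsCauchy (Φ : Distributor A B) : Prop :=
  ∃ Ψ : Distributor B A, id A ≤ Φ.comp Ψ ∧ Ψ.comp Φ ≤ id B

end Distributor

/-- The distributor `𝔹(-, F-) : 𝔸 ⇸ 𝔹` represented by a functor. -/
def QFunctor.graph (F : QFunctor A B) : Distributor A B where
  app b a := B.hom b (F.map a)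
  left_le _ _ _ := B.comp_le _ _ _
  right_le _ _ _ := (comp_le_comp (F.hom_le _ _) le_rfl).trans (B.comp_le _ _ _)

/-- The distributor `𝔹(F-, -) : 𝔹 ⇸ 𝔸` represented by a functor. -/
def QFunctor.cograph (F : QFunctor A B) : Distributor B A where
  app a b := B.hom (F.map a) b
  left_le _ _ _ := (comp_le_comp le_rfl (F.hom_le _ _)).trans (B.comp_le _ _ _)
  right_le _ _ _ := B.comp_le _ _ _

/-- A `Q`-category `ℂ` is Cauchy complete when every Cauchy distributor into `ℂ` is represented by
a functor. -/
def QCat.IsCauchyComplete (C : QCat Q) : Prop :=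
  ∀ (A : QCat Q) (Φ : Distributor A C), Φ.IsCauchy → ∃ F : QFunctor A C, F.graph = Φ

/-! ### Weighted colimits -/

/-- `K` is the `Φ`-weighted colimit of `F` when `ℂ(K-, -) = [Φ, ℂ(F-, -)]`. -/
def IsWeightedColimit (Φ : Distributor A B) (F : QFunctor B C) (K : QFunctor A C) : Prop :=
  K.cograph = Distributor.lift Φ F.cograph

/-- A `Q`-category is cocomplete when it admits all weighted colimits. -/
def QCat.IsCocomplete (C : QCat Q) : Prop :=
  ∀ (A B : QCat Q) (Φ : Distributor A B) (F : QFunctor B C),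
    ∃ K : QFunctor A C, IsWeightedColimit Φ F K

/-- A functor is cocontinuous when it preserves all weighted colimits that exist in its domain. -/
def QFunctor.IsCocontinuous (H : QFunctor C D) : Prop :=
  ∀ (A B : QCat Q) (Φ : Distributor A B) (F : QFunctor B C) (K : QFunctor A C),
    IsWeightedColimit Φ F K → IsWeightedColimit Φ (F.comp H) (K.comp H)

theorem QFunctor.IsAdjoint.hom_eq {F : QFunctor A B} {G : QFunctor B A} (h : F.IsAdjoint G)
    (b : B.Obj Y) (a : A.Obj X) : B.hom (F.map a) b = A.hom a (G.map b) := by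
  apply le_antisymm
  · exact (G.hom_le _ _).trans (QCat.Le.hom_le_hom' (h.1 X a) _)
  · exact (F.hom_le _ _).trans (QCat.Le.hom_le_hom (h.2 Y b) _)

theorem isWeightedColimit_iff {Φ : Distributor A B} {F : QFunctor B C} {K : QFunctor A C} :
    IsWeightedColimit Φ F K ↔ ∀ (X Y : Q) (a : A.Obj X) (c : C.Obj Y),
      C.hom (K.map a) c = (Distributor.lift Φ F.cograph).app a c := by
  constructor
  · intro h X Y a c
    rw [← show K.cograph = _ from h]
    rfl
  · exact fun h => Distributor.ext' fun X Y a c => h Y X a c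

theorem QFunctor.IsAdjoint.isCocontinuous {F : QFunctor C D} {G : QFunctor D C}
    (h : F.IsAdjoint G) : F.IsCocontinuous := by
  intro A B Φ H K hK
  rw [isWeightedColimit_iff] at hK ⊢
  intro X Y a d
  refine (h.hom_eq d (K.map a)).trans ((hK X Y a (G.map d)).trans ?_)
  refine eq_of_forall_le_iff fun k => ?_
  simp only [Distributor.le_lift_app]
  exact forall₂_congr fun Z b => by
    rw [show (H.comp F).cograph.app b d = H.cograph.app b (G.map d) from h.hom_eq d (H.map b)]

/-! ### Presheaves -/

/-- The object set of the one-object `Q`-category `*_X`: one object, of type `X`. -/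
inductive Pt (X : Q) : Q → Type u
  | pt : Pt X X

/-- The one-object `Q`-category `*_X` whose single hom-arrow is `1_X`. -/
def QCat.star (X : Q) : QCat Q where
  Obj := Pt X
  hom p q := match p, q with
    | .pt, .pt => 𝟙 X
  comp_le := by
    rintro _ _ _ ⟨⟩ ⟨⟩ ⟨⟩
    exact (Category.id_comp (𝟙 X)).le
  id_le := by
    rintro _ ⟨⟩
    exact le_rfl

/-- The object of `*_X`. -/
def QCat.pt (X : Q) : (QCat.star X).Obj X := Pt.pt

/-- The functor `Δa : *_{ta} ⟶ 𝔸` determined by an object `a`. -/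
def QCat.delta (A : QCat Q) (a : A.Obj X) : QFunctor (QCat.star X) A where
  map p := match p with
    | .pt => a
  hom_le := by
    rintro _ _ ⟨⟩ ⟨⟩
    exact A.id_le a

/-- Contravariant presheaves of type `X` on `𝔸`: distributors `*_X ⇸ 𝔸`. -/
abbrev QCat.Presheaf (A : QCat Q) (X : Q) := Distributor (QCat.star X) A

theorem QCat.Presheaf.ext_pt {φ ψ : A.Presheaf X}
    (h : ∀ (Y : Q) (a : A.Obj Y), φ.app a (pt X) = ψ.app a (pt X)) : φ = ψ := by
  ext _ Y a p
  obtain ⟨⟩ := p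
  exact h Y a

/-- The `Q`-category `𝒫𝔸` of presheaves on `𝔸`; the hom-arrow `𝒫𝔸(ψ, φ) : tφ ⟶ tψ` is the single
element of the lifting `[ψ, φ] : *_{tφ} ⇸ *_{tψ}`. -/
def QCat.psh (A : QCat Q) : QCat Q where
  Obj X := A.Presheaf X
  hom {X Y} ψ φ := (Distributor.lift ψ φ).app (pt Y) (pt X)
  comp_le {X Y Z} χ ψ φ := by
    refine Distributor.le_lift_app.mpr fun W a => ?_
    rw [Category.assoc]
    exact (comp_le_comp le_rfl (Distributor.le_lift_app.mp le_rfl W a)).trans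
      (Distributor.le_lift_app.mp le_rfl W a)
  id_le φ := Distributor.le_lift_app.mpr fun W a => (Category.id_comp _).le

theorem QCat.le_psh_hom {ψ : A.psh.Obj Y} {φ : A.psh.Obj X} {h : X ⟶ Y} :
    h ≤ A.psh.hom ψ φ ↔
      ∀ (Z : Q) (a : A.Obj Z), h ≫ Distributor.app ψ a (pt Y) ≤ Distributor.app φ a (pt X) :=
  Distributor.le_lift_app

theorem QCat.psh_le {ψ φ : A.psh.Obj X} : A.psh.Le ψ φ ↔
    ∀ (Z : Q) (a : A.Obj Z), Distributor.app ψ a (pt X) ≤ Distributor.app φ a (pt X) := by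
  rw [QCat.Le, QCat.le_psh_hom]
  simp only [Category.id_comp]

/-- The representable presheaf `𝔸(-, a) : *_{ta} ⇸ 𝔸`. -/
def QCat.representable (A : QCat Q) (a : A.Obj X) : A.Presheaf X := (A.delta a).graph

/-- The Yoneda embedding `𝔸 ⟶ 𝒫𝔸`. -/
def QCat.yoneda (A : QCat Q) : QFunctor A A.psh where
  map a := A.representable a
  hom_le _ _ := QCat.le_psh_hom.mpr fun _ _ => A.comp_le _ _ _

theorem QCat.psh_hom_representable (φ : A.psh.Obj X) (a : A.Obj Y) :
    A.psh.hom (A.yoneda.map a) φ = Distributor.app φ a (pt X) := by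
  apply le_antisymm
  · have h := QCat.le_psh_hom.mp (le_refl (A.psh.hom (A.yoneda.map a) φ)) Y a
    refine le_trans ?_ h
    have h' := comp_le_comp (le_refl (A.psh.hom (A.yoneda.map a) φ)) (A.id_le a)
    rwa [Category.comp_id] at h'
  · exact QCat.le_psh_hom.mpr fun Z b => Distributor.left_le φ _ _ _

theorem QCat.psh_isCocomplete (C : QCat Q) : C.psh.IsCocomplete := by
  intro A B Φ F
  have key : ∀ {X : Q} (a : A.Obj X), ∃ k : C.psh.Obj X, ∀ (Y : Q) (ψ : C.psh.Obj Y),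
      C.psh.hom k ψ = (Distributor.lift Φ F.cograph).app a ψ := by
    intro X a
    let k : C.psh.Obj X :=
      { app := fun {W Z} c p => match p with
          | .pt => ⨆ (Y : Q) (b : B.Obj Y), Φ.app b a ≫ Distributor.app (F.map b) c (pt Y)
        left_le := by
          rintro _ _ _ c c' ⟨⟩
          simp only [iSup_comp, Category.assoc]
          exact iSup₂_mono fun Y b => comp_le_comp le_rfl (Distributor.left_le _ _ _ _)
        right_le := by
          rintro _ _ _ c ⟨⟩ ⟨⟩
          exact (Category.id_comp _).le }
    refine ⟨k, fun Y ψ => eq_of_forall_le_iff fun h => ?_⟩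
    rw [QCat.le_psh_hom, Distributor.le_lift_app]
    constructor
    · intro H Z b
      refine QCat.le_psh_hom.mpr fun W c => le_trans ?_ (H W c)
      rw [Category.assoc]
      exact comp_le_comp le_rfl (le_iSup₂_of_le Z b le_rfl)
    · intro H W c
      change h ≫ (⨆ (Y : Q) (b : B.Obj Y), Φ.app b a ≫ Distributor.app (F.map b) c (pt Y)) ≤ _
      simp only [comp_iSup]
      refine iSup₂_le fun Z b => ?_
      rw [← Category.assoc]
      exact QCat.le_psh_hom.mp (H Z b) W c
  choose k hk using @key
  refine ⟨⟨k, fun {X Y} a' a => ?_⟩, ?_⟩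
  · rw [hk a' X (k a), Distributor.le_lift_app]
    intro Z b
    have h1 := Distributor.le_lift_app.mp (hk a X (k a) ▸ C.psh.id_le (k a)) Z b
    rw [Category.id_comp] at h1
    exact (Φ.right_le _ _ _).trans h1
  · exact isWeightedColimit_iff.mpr fun X Y a ψ => hk a Y ψ

theorem QCat.psh_le_iff {ψ φ : A.Presheaf X} : A.psh.Le (X := X) ψ φ ↔ ψ ≤ φ := by
  refine QCat.psh_le.trans ⟨?_, fun h Z a => h _ _ a _⟩
  rintro h W Z a ⟨⟩
  exact h Z a

/-- The functor `Φ ⊗ - : 𝒫𝔸 ⟶ 𝒫𝔹`. -/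
def Distributor.tensor (Φ : Distributor A B) : QFunctor A.psh B.psh where
  map φ := Distributor.comp φ Φ
  hom_le ψ φ := QCat.le_psh_hom.mpr fun Z b => by
    simp only [Distributor.comp, comp_iSup, ← Category.assoc]
    exact iSup₂_mono fun W a => comp_le_comp (QCat.le_psh_hom.mp le_rfl W a) le_rfl

/-- The functor `[Φ, -] : 𝒫𝔹 ⟶ 𝒫𝔸`. -/
def Distributor.cotensor (Φ : Distributor A B) : QFunctor B.psh A.psh where
  map φ := Distributor.lift Φ φ
  hom_le ψ φ := QCat.le_psh_hom.mpr fun Z a => Distributor.le_lift_app.mpr fun W b => by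
    rw [Category.assoc]
    exact (comp_le_comp le_rfl (Distributor.le_lift_app.mp le_rfl W b)).trans
      (QCat.le_psh_hom.mp le_rfl W b)

theorem Distributor.tensor_isAdjoint_cotensor (Φ : Distributor A B) :
    Φ.tensor.IsAdjoint Φ.cotensor :=
  ⟨fun _ _ => QCat.psh_le_iff.mpr (Distributor.le_lift_iff.mpr le_rfl),
    fun _ _ => QCat.psh_le_iff.mpr (Distributor.le_lift_iff.mp le_rfl)⟩

theorem QFunctor.graph_adjoint_cograph (F : QFunctor A B) :
    Distributor.id A ≤ F.graph.comp F.cograph ∧ F.cograph.comp F.graph ≤ Distributor.id B := by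
  constructor
  · intro X Y a' a
    refine le_iSup₂_of_le X (F.map a) ?_
    have h := comp_le_comp (B.id_le (F.map a)) (F.hom_le a' a)
    rw [Category.id_comp] at h
    exact h
  · exact fun X Y b' b => iSup₂_le fun Z a => B.comp_le _ _ _

theorem QFunctor.tensor_graph_isAdjoint (F : QFunctor A B) :
    F.graph.tensor.IsAdjoint F.cograph.tensor := by
  have h1 : ∀ {X : Q} (φ : A.Presheaf X), φ ≤ (φ.comp F.graph).comp F.cograph := fun {X} φ => by
    rw [Distributor.comp_assoc]
    calc φ = φ.comp (Distributor.id A) := (Distributor.comp_id φ).symm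
      _ ≤ _ := Distributor.comp_mono le_rfl F.graph_adjoint_cograph.1
  have h2 : ∀ {X : Q} (φ : B.Presheaf X), (φ.comp F.cograph).comp F.graph ≤ φ := fun {X} φ => by
    rw [Distributor.comp_assoc]
    calc _ ≤ φ.comp (Distributor.id B) :=
          Distributor.comp_mono le_rfl F.graph_adjoint_cograph.2
      _ = φ := Distributor.comp_id φ
  exact ⟨fun X φ => QCat.psh_le_iff.mpr (h1 φ), fun X φ => QCat.psh_le_iff.mpr (h2 φ)⟩

theorem QFunctor.graph_comp (F : QFunctor A B) (G : QFunctor B C) :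
    (F.comp G).graph = F.graph.comp G.graph := by
  ext Y Z c a
  apply le_antisymm
  · refine le_iSup₂_of_le Y (F.map a) ?_
    have h := comp_le_comp (B.id_le (F.map a)) (le_refl (C.hom c (G.map (F.map a))))
    rw [Category.id_comp] at h
    exact h
  · exact iSup₂_le fun W b => (comp_le_comp (G.hom_le _ _) le_rfl).trans (C.comp_le _ _ _)

theorem QFunctor.graph_mono {F G : QFunctor A B} (h : F ≤ G) : F.graph ≤ G.graph :=
  fun _ _ b a => QCat.Le.hom_le_hom (h _ a) b

theorem QFunctor.tensor_graph_comp (F : QFunctor A B) (G : QFunctor B C) :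
    (F.comp G).graph.tensor = F.graph.tensor.comp G.graph.tensor := by
  rw [QFunctor.graph_comp]
  exact QFunctor.ext' fun X φ => (Distributor.comp_assoc φ F.graph G.graph).symm

theorem Distributor.tensor_mono {Φ Ψ : Distributor A B} (h : Φ ≤ Ψ) : Φ.tensor ≤ Ψ.tensor :=
  fun _ _ => QCat.psh_le_iff.mpr (Distributor.comp_mono le_rfl h)

/-! ### Totally compact objects -/

theorem QCat.IsCocomplete.exists_sup (hA : A.IsCocomplete) (φ : A.psh.Obj X) :
    ∃ a : A.Obj X, IsWeightedColimit φ (QFunctor.id A) (A.delta a) := by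
  obtain ⟨K, hK⟩ := hA _ _ φ (QFunctor.id A)
  refine ⟨K.map (pt X), ?_⟩
  have : A.delta (K.map (pt X)) = K := by
    ext Y p
    obtain ⟨⟩ := p
    rfl
  rwa [this]

/-- The object `colim(φ, 1_𝔸)` of a cocomplete `Q`-category. -/
noncomputable def QCat.IsCocomplete.supObj (hA : A.IsCocomplete) (φ : A.psh.Obj X) : A.Obj X :=
  Classical.choose (hA.exists_sup φ)

theorem QCat.IsCocomplete.supObj_spec (hA : A.IsCocomplete) (φ : A.psh.Obj X) :
    IsWeightedColimit φ (QFunctor.id A) (A.delta (hA.supObj φ)) :=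
  Classical.choose_spec (hA.exists_sup φ)

theorem QCat.IsCocomplete.le_hom_supObj (hA : A.IsCocomplete) {φ : A.psh.Obj X} {x : A.Obj Y}
    {h : Y ⟶ X} : h ≤ A.hom (hA.supObj φ) x ↔
      ∀ (Z : Q) (a : A.Obj Z), h ≫ Distributor.app φ a (pt X) ≤ A.hom a x := by
  rw [show A.hom (hA.supObj φ) x = _ from
    isWeightedColimit_iff.mp (hA.supObj_spec φ) X Y (pt X) x]
  exact Distributor.le_lift_app

theorem QCat.IsCocomplete.le_supObj (hA : A.IsCocomplete) (φ : A.psh.Obj X) (a : A.Obj Y) :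
    Distributor.app φ a (pt X) ≤ A.hom a (hA.supObj φ) := by
  have h := hA.le_hom_supObj.mp (A.id_le (hA.supObj φ)) Y a
  rwa [Category.id_comp] at h

/-- The functor `sup_𝔸 : 𝒫𝔸 ⟶ 𝔸`, `φ ↦ colim(φ, 1_𝔸)`, of a cocomplete `Q`-category. -/
noncomputable def QCat.IsCocomplete.sup (hA : A.IsCocomplete) : QFunctor A.psh A where
  map φ := hA.supObj φ
  hom_le _ φ := hA.le_hom_supObj.mpr fun Z a =>
    (QCat.le_psh_hom.mp le_rfl Z a).trans (hA.le_supObj φ a)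

/-- The totally below distributor `Θ_𝔸 = {𝔸(-, sup_𝔸 -), 𝒫𝔸(Y_𝔸 -, -)}` on a cocomplete
`Q`-category. -/
noncomputable def QCat.IsCocomplete.totallyBelow (hA : A.IsCocomplete) : Distributor A A :=
  Distributor.ext hA.sup.graph A.yoneda.cograph

/-- An object `a` is totally compact when `1_{ta} ≤ Θ_𝔸(a, a)`. -/
def QCat.IsCocomplete.IsTotallyCompact (hA : A.IsCocomplete) (a : A.Obj X) : Prop :=
  𝟙 X ≤ hA.totallyBelow.app a a

theorem QCat.IsCocomplete.isTotallyCompact_iff (hA : A.IsCocomplete) (a : A.Obj X) :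
    hA.IsTotallyCompact a ↔ ∀ (Y : Q) (φ : A.psh.Obj Y),
      A.hom a (hA.supObj φ) ≤ Distributor.app φ a (pt Y) := by
  refine Distributor.le_ext_app.trans (forall₂_congr fun Y φ => ?_)
  rw [Category.comp_id]
  exact Iff.of_eq (congrArg _ (QCat.psh_hom_representable φ a))

theorem QCat.IsCocomplete.isTotallyCompact_map (hA : A.IsCocomplete) (hB : B.IsCocomplete)
    {F : QFunctor A B} {H : QFunctor B A} (hH : H.IsCocontinuous) (hF : F.IsAdjoint H)
    {a : A.Obj X} (ha : hA.IsTotallyCompact a) : hB.IsTotallyCompact (F.map a) := by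
  rw [QCat.IsCocomplete.isTotallyCompact_iff] at ha ⊢
  intro Y ψ
  let ψ' : A.psh.Obj Y := Distributor.comp ψ H.graph
  have h1 : A.Le (H.map (hB.supObj ψ)) (hA.supObj ψ') := by
    have h := isWeightedColimit_iff.mp (hH _ _ _ _ _ (hB.supObj_spec ψ)) Y Y (pt Y) (hA.supObj ψ')
    refine le_of_le_of_eq (Distributor.le_lift_app.mpr fun Z b => ?_) h.symm
    rw [Category.id_comp]
    refine le_trans ?_ (hA.le_supObj ψ' (H.map b))
    refine le_iSup₂_of_le Z b ?_
    have h2 := comp_le_comp (le_refl (Distributor.app ψ b (pt Y))) (A.id_le (H.map b))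
    rwa [Category.comp_id] at h2
  rw [hF.hom_eq]
  refine (h1.hom_le_hom a).trans ((ha Y ψ').trans (iSup₂_le fun Z b => ?_))
  refine le_trans (comp_le_comp le_rfl (hF.hom_eq b a).ge) ?_
  exact Distributor.left_le ψ _ _ _

/-- The full subcategory on the objects that satisfy `p`. -/
def QCat.full (A : QCat Q) (p : ∀ {X : Q}, A.Obj X → Prop) : QCat Q where
  Obj X := {a : A.Obj X // p a}
  hom a' a := A.hom a'.1 a.1
  comp_le _ _ _ := A.comp_le _ _ _
  id_le _ := A.id_le _

/-- The full embedding of a full subcategory. -/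
def QCat.fullIncl (A : QCat Q) (p : ∀ {X : Q}, A.Obj X → Prop) : QFunctor (A.full p) A :=
  ⟨fun a => a.1, fun _ _ => le_rfl⟩

/-- `L` is the left Kan extension of `G` along `F` in the locally ordered 2-category `Cat(Q)`. -/
def IsLeftKanExtension (F : QFunctor A B) (G : QFunctor A C) (L : QFunctor B C) : Prop :=
  ∀ K : QFunctor B C, L ≤ K ↔ G ≤ F.comp K

end Basic

/-! ### The 2-category `Map(Cocont(Q))` -/

/-- Cocomplete `Q`-categories: the objects of `Cocont(Q)`, and of `Map(Cocont(Q))`. -/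
structure MapCocont (Q : Type u) [Quantaloid Q] where
  cat : QCat Q
  isCocomplete : cat.IsCocomplete

/-- Left adjoints in `Cocont(Q)`: cocontinuous functors that admit a right adjoint in `Cat(Q)`
which is itself cocontinuous. -/
structure MapCocont.Hom {Q : Type u} [Quantaloid Q] (A B : MapCocont Q) where
  functor : QFunctor A.cat B.cat
  isCocontinuous : functor.IsCocontinuous
  exists_rightAdjoint : ∃ G : QFunctor B.cat A.cat, G.IsCocontinuous ∧ functor.IsAdjoint G

section Functors

variable {Q : Type u} [Quantaloid Q]

namespace MapCocont

@[ext]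
theorem Hom.ext' {A B : MapCocont Q} {F G : Hom A B} (h : F.functor = G.functor) : F = G := by
  obtain ⟨f, _, _⟩ := F
  obtain ⟨g, _, _⟩ := G
  obtain rfl : f = g := h
  rfl

instance (A B : MapCocont Q) : Preorder (Hom A B) := Preorder.lift Hom.functor

/-- The identity functor, as a left adjoint in `Cocont(Q)`. -/
def Hom.id (A : MapCocont Q) : Hom A A where
  functor := QFunctor.id A.cat
  isCocontinuous _ _ _ _ _ h := h
  exists_rightAdjoint := ⟨QFunctor.id A.cat, fun _ _ _ _ _ h => h, le_rfl, le_rfl⟩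

/-- The composite of left adjoints in `Cocont(Q)`. -/
def Hom.comp {A B C : MapCocont Q} (F : Hom A B) (G : Hom B C) : Hom A C where
  functor := F.functor.comp G.functor
  isCocontinuous _ _ _ _ _ h := G.isCocontinuous _ _ _ _ _ (F.isCocontinuous _ _ _ _ _ h)
  exists_rightAdjoint := by
    obtain ⟨F', hF, h1, h2⟩ := F.exists_rightAdjoint
    obtain ⟨G', hG, k1, k2⟩ := G.exists_rightAdjoint
    refine ⟨G'.comp F', fun _ _ _ _ _ h => hF _ _ _ _ _ (hG _ _ _ _ _ h), ?_, ?_⟩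
    · exact h1.trans (QFunctor.comp_mono (QFunctor.comp_mono (le_refl F.functor) k1) (le_refl F'))
    · exact (QFunctor.comp_mono (QFunctor.comp_mono (le_refl G') h2) (le_refl G.functor)).trans k2

/-- `Map(Cocont(Q))`: the locally ordered 2-category of cocomplete `Q`-categories and left adjoints
in `Cocont(Q)`, ordered as functors. -/
instance bicategory : Bicategory.{u, u} (MapCocont Q) where
  Hom A B := Hom A B
  id A := Hom.id A
  comp F G := F.comp G
  homCategory _ _ := Preorder.smallCategory _
  whiskerLeft F _ _ θ := homOfLE (QFunctor.comp_mono (le_refl (Hom.functor F)) (CategoryTheory.leOfHom θ))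
  whiskerRight θ G := homOfLE (QFunctor.comp_mono (CategoryTheory.leOfHom θ) (le_refl (Hom.functor G)))
  associator _ _ _ := Iso.refl _
  leftUnitor _ := Iso.refl _
  rightUnitor _ := Iso.refl _

instance isThin (A B : MapCocont Q) : Quiver.IsThin (A ⟶ B) :=
  fun F G => inferInstanceAs (Subsingleton (ULift (PLift ((show Hom A B from F) ≤ G))))

/-- The 2-cell given by an inequality of functors. -/
def homOfLe {A B : MapCocont Q} {F G : A ⟶ B} (h : Hom.functor F ≤ Hom.functor G) : F ⟶ G :=
  ⟨⟨h⟩⟩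

theorem leOfHom {A B : MapCocont Q} {F G : A ⟶ B} (θ : F ⟶ G) :
    Hom.functor F ≤ Hom.functor G := θ.down.down

instance strict : Bicategory.Strict (MapCocont Q) where
  id_comp _ := rfl
  comp_id _ := rfl
  assoc _ _ _ := rfl
  leftUnitor_eqToIso _ := rfl
  rightUnitor_eqToIso _ := rfl
  associator_eqToIso _ _ _ := rfl

/-- The `Q`-category `𝔸_c` of totally compact objects of a cocomplete `Q`-category. -/
def compacts (A : MapCocont Q) : QCat Q := A.cat.full A.isCocomplete.IsTotallyCompact

/-- The full embedding `i_𝔸 : 𝔸_c ⟶ 𝔸`. -/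
def incl (A : MapCocont Q) : QFunctor A.compacts A.cat :=
  A.cat.fullIncl A.isCocomplete.IsTotallyCompact

/-- `𝔸` is totally algebraic when the left Kan extension of `i_𝔸` along itself is isomorphic to the
identity. -/
def IsTotallyAlgebraic (A : MapCocont Q) : Prop :=
  ∃ L : QFunctor A.cat A.cat, IsLeftKanExtension A.incl A.incl L ∧
    L ≤ QFunctor.id A.cat ∧ QFunctor.id A.cat ≤ L

end MapCocont

/-- The 2-functor `𝒫 : Cat(Q) ⟶ Map(Cocont(Q))`, sending `F : ℂ ⟶ 𝔻` to
`𝔻(-, F-) ⊗ - : 𝒫ℂ ⟶ 𝒫𝔻`. -/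
def presheafFunctor (Q : Type u) [Quantaloid Q] : StrictPseudofunctor (QCat Q) (MapCocont Q) :=
  StrictPseudofunctor.mk''
    { obj := fun C => ⟨C.psh, C.psh_isCocomplete⟩
      map := fun F =>
        { functor := (QFunctor.graph F).tensor
          isCocontinuous := (QFunctor.tensor_graph_isAdjoint F).isCocontinuous
          exists_rightAdjoint := ⟨(QFunctor.cograph F).tensor,
            (Distributor.tensor_isAdjoint_cotensor _).isCocontinuous,
            QFunctor.tensor_graph_isAdjoint F⟩ }
      map₂ := fun θ =>
        MapCocont.homOfLe (Distributor.tensor_mono (QFunctor.graph_mono (QCat.leOfHom θ)))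
      map₂_id := fun _ => Subsingleton.elim _ _
      map₂_comp := fun _ _ => Subsingleton.elim _ _
      map_id := fun _ => MapCocont.Hom.ext' (QFunctor.ext' fun _ φ => Distributor.comp_id φ)
      map_comp := fun F G => MapCocont.Hom.ext' (QFunctor.tensor_graph_comp F G)
      map₂_whisker_left := fun _ _ _ _ => Subsingleton.elim _ _
      map₂_whisker_right := fun _ _ => Subsingleton.elim _ _ }

/-- The 2-functor `(-)_c : Map(Cocont(Q)) ⟶ Cat(Q)`, sending `F : 𝔸 ⟶ 𝔹` to its restriction
`𝔸_c ⟶ 𝔹_c`. -/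
def compactFunctor (Q : Type u) [Quantaloid Q] : StrictPseudofunctor (MapCocont Q) (QCat Q) :=
  StrictPseudofunctor.mk''
    { obj := fun A => A.compacts
      map := fun {A B} F =>
        { map := fun a => ⟨(MapCocont.Hom.functor F).map a.1, by
            obtain ⟨H, hH, hF⟩ := MapCocont.Hom.exists_rightAdjoint F
            exact A.isCocomplete.isTotallyCompact_map B.isCocomplete hH hF a.2⟩
          hom_le := fun _ _ => (MapCocont.Hom.functor F).hom_le _ _ }
      map₂ := fun θ => QCat.homOfLe fun X a => MapCocont.leOfHom θ X a.1
      map₂_id := fun _ => Subsingleton.elim _ _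
      map₂_comp := fun _ _ => Subsingleton.elim _ _
      map_id := fun _ => rfl
      map_comp := fun _ _ => rfl
      map₂_whisker_left := fun _ _ _ _ => Subsingleton.elim _ _
      map₂_whisker_right := fun _ _ => Subsingleton.elim _ _ }

end Functors

/-! ### Biadjunctions and biequivalences -/

section Biadjunctions

variable {B : Type u₁} [Bicategory.{w₁, v₁} B] {C : Type u₂} [Bicategory.{w₂, v₂} C]

/-- A 1-cell is an equivalence when it is part of an (adjoint) equivalence. -/
def IsEquivalenceHom {a b : B} (f : a ⟶ b) : Prop := ∃ e : Bicategory.Equivalence a b, e.hom = f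

/-- A pseudofunctor is a biequivalence when it is an equivalence on hom-categories and essentially
surjective on objects up to equivalence. -/
def IsBiequivalence (F : Pseudofunctor B C) : Prop :=
  (∀ a b : B, (F.mapFunctor a b).IsEquivalence) ∧
    ∀ c : C, ∃ b : B, Nonempty (Bicategory.Equivalence (F.obj b) c)

/-- A biadjunction `F ⊣ G` between locally ordered bicategories: a pseudonatural unit and counit
that satisfy the triangle identities up to invertible 2-cells. All coherence conditions on these
2-cells hold automatically, because parallel 2-cells are equal. -/
structure Biadjunction [∀ a b : B, Quiver.IsThin (a ⟶ b)] [∀ a b : C, Quiver.IsThin (a ⟶ b)]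
    (F : Pseudofunctor B C) (G : Pseudofunctor C B) where
  unit : Pseudofunctor.StrongTrans (Pseudofunctor.id B) (F.comp G)
  counit : Pseudofunctor.StrongTrans (G.comp F) (Pseudofunctor.id C)
  left_triangle : ∀ b : B, F.map (unit.app b) ≫ counit.app (F.obj b) ≅ 𝟙 (F.obj b)
  right_triangle : ∀ c : C, unit.app (G.obj c) ≫ G.map (counit.app c) ≅ 𝟙 (G.obj c)

/-- The full sub-bicategory on the objects that satisfy `p`. -/
abbrev FullSub (p : B → Prop) : Type u₁ := InducedBicategory B (Subtype.val : {b : B // p b} → B)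

instance FullSub.isThin [∀ a b : B, Quiver.IsThin (a ⟶ b)] (p : B → Prop) (a b : FullSub p) :
    Quiver.IsThin (a ⟶ b) :=
  fun _ _ => ⟨fun _ _ => InducedBicategory.hom₂_ext (Subsingleton.elim _ _)⟩

/-- The restriction of a 2-functor to full sub-bicategories. -/
def restrictFunctor [Bicategory.Strict B] [Bicategory.Strict C]
    [∀ a b : C, Quiver.IsThin (a ⟶ b)] (F : StrictPseudofunctor B C) {p : B → Prop}
    {q : C → Prop} (h : ∀ b, p b → q (F.obj b)) :
    StrictPseudofunctor (FullSub p) (FullSub q) :=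
  StrictPseudofunctor.mk''
    { obj := fun b => ⟨F.obj b.1, h b.1 b.2⟩
      map := fun f => InducedBicategory.mkHom (F.map f.hom)
      map₂ := fun θ => InducedBicategory.mkHom₂ (F.map₂ θ.hom)
      map₂_id := fun _ => InducedBicategory.hom₂_ext (Subsingleton.elim _ _)
      map₂_comp := fun _ _ => InducedBicategory.hom₂_ext (Subsingleton.elim _ _)
      map_id := fun b => InducedBicategory.hom_ext (F.map_id b.1)
      map_comp := fun f g => InducedBicategory.hom_ext (F.map_comp f.hom g.hom)
      map₂_whisker_left := fun _ _ _ _ => InducedBicategory.hom₂_ext (Subsingleton.elim _ _)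
      map₂_whisker_right := fun _ _ => InducedBicategory.hom₂_ext (Subsingleton.elim _ _) }

/-- The restriction of a biadjunction of 2-functors to full sub-bicategories which the 2-functors
map into each other; its unit and counit have the same components. -/
def Biadjunction.restrict [Bicategory.Strict B] [Bicategory.Strict C]
    [∀ a b : B, Quiver.IsThin (a ⟶ b)] [∀ a b : C, Quiver.IsThin (a ⟶ b)]
    {F : StrictPseudofunctor B C} {G : StrictPseudofunctor C B}
    (β : Biadjunction F.toPseudofunctor G.toPseudofunctor) {p : B → Prop} {q : C → Prop}
    (hF : ∀ b, p b → q (F.obj b)) (hG : ∀ c, q c → p (G.obj c)) :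
    Biadjunction (restrictFunctor F hF).toPseudofunctor (restrictFunctor G hG).toPseudofunctor where
  unit :=
    { app := fun b => InducedBicategory.mkHom (β.unit.app b.1)
      naturality := fun f => InducedBicategory.isoMk (β.unit.naturality f.hom)
      naturality_naturality := fun _ => Subsingleton.elim _ _
      naturality_id := fun _ => Subsingleton.elim _ _
      naturality_comp := fun _ _ => Subsingleton.elim _ _ }
  counit :=
    { app := fun c => InducedBicategory.mkHom (β.counit.app c.1)
      naturality := fun f => InducedBicategory.isoMk (β.counit.naturality f.hom)
      naturality_naturality := fun _ => Subsingleton.elim _ _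
      naturality_id := fun _ => Subsingleton.elim _ _
      naturality_comp := fun _ _ => Subsingleton.elim _ _ }
  left_triangle b := InducedBicategory.isoMk (β.left_triangle b.1)
  right_triangle c := InducedBicategory.isoMk (β.right_triangle c.1)

end Biadjunctions

/-! ### Weighted colimits and presheaves -/

section Presheaves

variable {Q : Type u} [Quantaloid Q] {A B C D : QCat Q} {X Y Z : Q}

/-! Everything rests on one fact about a totally compact object `c`: `C.hom c -` preserves every
weighted colimit (`IsTotallyCompact.hom_colimit`). Colimits of presheaves are pointwise, so the
nerve `x ↦ 𝔸(i-, x)` from `𝔸` to `𝒫(𝔸_c)` is cocontinuous. It is right adjoint to the realization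
`R`, so `R` is a 1-cell of `Map(Cocont(Q))` and can serve as counit. The same fact gives
`nerve_realization`: nerve after `R` is the identity.

Conversely, representables are totally compact in `𝒫ℂ` by the Yoneda lemma, which gives the unit.
Naturality of the counit and the triangle identities come from comparing hom-arrows out of colimits,
mainly through `le_hom_realization_tensor`. Since both 2-categories are locally ordered, no
coherence needs checking.

A presheaf is totally compact exactly when it is a left adjoint distributor, so the unit is an
equivalence exactly when all such presheaves are representable, that is, when `ℂ` is Cauchy
complete. Because nerve after `R` is the identity, `R` is an equivalence exactly when `1 ≤ R ∘
nerve`, which is total algebraicity. Presheaf categories satisfy this by co-Yoneda. A totally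
compact presheaf on `𝔸_c` is represented by its realization, so `𝔸_c` is Cauchy complete. The
biequivalence then follows formally from invertibility of the restricted unit and counit. -/

theorem QCat.le_of_eq {a b : A.Obj X} (h : a = b) : A.Le a b := h ▸ A.id_le a

theorem QCat.le_of_forall_hom_le {a b : A.Obj X}
    (h : ∀ (Y : Q) (x : A.Obj Y), A.hom b x ≤ A.hom a x) : A.Le a b :=
  (A.id_le b).trans (h X b)

theorem QCat.psh_le_antisymm {φ ψ : A.psh.Obj X} (h : A.psh.Le φ ψ) (k : A.psh.Le ψ φ) : φ = ψ :=
  le_antisymm (α := A.Presheaf X) (QCat.psh_le_iff.mp h) (QCat.psh_le_iff.mp k)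

/-- Elementwise form of the universal property: testing against arbitrary arrows `h` replaces
equations between liftings by inequalities. -/
theorem IsWeightedColimit.le_hom_iff {Φ : Distributor A B} {F : QFunctor B C} {K : QFunctor A C}
    (hK : IsWeightedColimit Φ F K) {a : A.Obj X} {c : C.Obj Y} {h : Y ⟶ X} :
    h ≤ C.hom (K.map a) c ↔ ∀ (Z : Q) (b : B.Obj Z), h ≫ Φ.app b a ≤ C.hom (F.map b) c := by
  rw [isWeightedColimit_iff.mp hK]
  exact Distributor.le_lift_app

theorem IsWeightedColimit.of_le_hom_iff {Φ : Distributor A B} {F : QFunctor B C}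
    {K : QFunctor A C}
    (hK : ∀ (X Y : Q) (a : A.Obj X) (c : C.Obj Y) (h : Y ⟶ X),
      h ≤ C.hom (K.map a) c ↔ ∀ (Z : Q) (b : B.Obj Z), h ≫ Φ.app b a ≤ C.hom (F.map b) c) :
    IsWeightedColimit Φ F K :=
  isWeightedColimit_iff.mpr fun X Y a c => eq_of_forall_le_iff fun h =>
    (hK X Y a c h).trans (Distributor.le_lift_app (Ψ := F.cograph)).symm

theorem IsWeightedColimit.le_hom {Φ : Distributor A B} {F : QFunctor B C} {K : QFunctor A C}
    (hK : IsWeightedColimit Φ F K) (b : B.Obj Y) (a : A.Obj X) :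
    Φ.app b a ≤ C.hom (F.map b) (K.map a) := by
  have h := hK.le_hom_iff.mp (C.id_le (K.map a)) Y b
  rwa [Category.id_comp] at h

/-- The pointwise colimit of a diagram of presheaves: `c ↦ ⋁_b (Fb)(c) ∘ Φ(b, a)`. -/
def Distributor.weightedSup (Φ : Distributor A B) (F : QFunctor B C.psh) (a : A.Obj X) :
    C.Presheaf X where
  app {W Z} c p := match p with
    | .pt => ⨆ (Y : Q) (b : B.Obj Y), Φ.app b a ≫ Distributor.app (F.map b) c (QCat.pt Y)
  left_le := by
    rintro _ _ _ c c' ⟨⟩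
    simp only [iSup_comp, Category.assoc]
    exact iSup₂_mono fun Y b => comp_le_comp le_rfl (Distributor.left_le _ _ _ _)
  right_le := by
    rintro _ _ _ c ⟨⟩ ⟨⟩
    exact (Category.id_comp _).le

theorem Distributor.weightedSup_app (Φ : Distributor A B) (F : QFunctor B C.psh) (a : A.Obj X)
    (c : C.Obj Z) : (Φ.weightedSup F a).app c (QCat.pt X) =
      ⨆ (Y : Q) (b : B.Obj Y), Φ.app b a ≫ Distributor.app (F.map b) c (QCat.pt Y) := rfl

theorem Distributor.le_psh_hom_weightedSup {Φ : Distributor A B} {F : QFunctor B C.psh}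
    {a : A.Obj X} {ψ : C.psh.Obj Y} {h : Y ⟶ X} :
    h ≤ C.psh.hom (Φ.weightedSup F a) ψ ↔
      ∀ (Z : Q) (b : B.Obj Z), h ≫ Φ.app b a ≤ C.psh.hom (F.map b) ψ := by
  refine QCat.le_psh_hom.trans ⟨fun H Z b => QCat.le_psh_hom.mpr fun W c => ?_, fun H W c => ?_⟩
  · refine le_trans ?_ (H W c)
    rw [Category.assoc, Distributor.weightedSup_app]
    exact comp_le_comp le_rfl (le_iSup₂_of_le Z b le_rfl)
  · rw [Distributor.weightedSup_app]
    simp only [comp_iSup, ← Category.assoc]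
    exact iSup₂_le fun Z b => QCat.le_psh_hom.mp (H Z b) W c

/-- The colimit is determined up to equality, not merely isomorphism, because the underlying order
on presheaves is antisymmetric. -/
theorem isWeightedColimit_psh_iff {Φ : Distributor A B} {F : QFunctor B C.psh}
    {K : QFunctor A C.psh} :
    IsWeightedColimit Φ F K ↔
      ∀ (X : Q) (a : A.Obj X), K.map a = Φ.weightedSup F a := by
  constructor
  · intro hK X a
    refine QCat.psh_le_antisymm (hK.le_hom_iff.mpr ?_)
      (Distributor.le_psh_hom_weightedSup.mpr (hK.le_hom_iff.mp (C.psh.id_le _)))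
    exact Distributor.le_psh_hom_weightedSup.mp (C.psh.id_le _)
  · intro hK
    refine .of_le_hom_iff fun X Y a ψ h => ?_
    rw [hK]
    exact Distributor.le_psh_hom_weightedSup

theorem QCat.psh_supObj_app (hC : C.psh.IsCocomplete) (ξ : C.psh.psh.Obj X) (c : C.Obj Y) :
    Distributor.app (hC.supObj ξ) c (pt X) =
      ⨆ (Z : Q) (θ : C.psh.Obj Z), Distributor.app ξ θ (pt X) ≫ Distributor.app θ c (pt Z) :=
  congrArg (fun φ : C.Presheaf X => φ.app c (pt X))
    (isWeightedColimit_psh_iff.mp (hC.supObj_spec ξ) X (pt X))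

/-- The co-Yoneda lemma: every presheaf is the colimit of representables weighted by itself. -/
theorem QCat.le_psh_hom_yoneda {φ : C.psh.Obj X} {ψ : C.psh.Obj Y} {h : Y ⟶ X} :
    h ≤ C.psh.hom φ ψ ↔ ∀ (Z : Q) (c : C.Obj Z),
      h ≫ Distributor.app φ c (pt X) ≤ C.psh.hom (C.yoneda.map c) ψ := by
  simp only [QCat.psh_hom_representable]
  exact QCat.le_psh_hom

theorem QCat.isWeightedColimit_yoneda (φ : C.psh.Obj X) :
    IsWeightedColimit φ C.yoneda (C.psh.delta φ) :=
  .of_le_hom_iff fun _ _ a _ _ => by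
    obtain ⟨⟩ := a
    exact QCat.le_psh_hom_yoneda

theorem QCat.psh_hom_yoneda_yoneda (c' : C.Obj Y) (c : C.Obj X) :
    C.psh.hom (C.yoneda.map c') (C.yoneda.map c) = C.hom c' c :=
  C.psh_hom_representable _ _

/-- The nerve `A ⟶ 𝒫B`, `a ↦ A(F-, a)`, of a functor `F : B ⟶ A`. -/
def QFunctor.nerve (F : QFunctor B A) : QFunctor A B.psh where
  map a :=
    { app := fun b p => A.hom (F.map b) ((A.delta a).map p)
      left_le := fun _ _ _ => (comp_le_comp le_rfl (F.hom_le _ _)).trans (A.comp_le _ _ _)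
      right_le := fun _ _ _ =>
        (comp_le_comp ((A.delta a).hom_le _ _) le_rfl).trans (A.comp_le _ _ _) }
  hom_le _ _ := QCat.le_psh_hom.mpr fun _ _ => A.comp_le _ _ _

/-! ### Totally compact objects and colimits -/

/-- Homming out of a totally compact object preserves weighted colimits. -/
theorem QCat.IsCocomplete.IsTotallyCompact.hom_colimit {hC : C.IsCocomplete} {c : C.Obj Z}
    (hc : hC.IsTotallyCompact c) {Φ : Distributor A B} {F : QFunctor B C} {K : QFunctor A C}
    (hK : IsWeightedColimit Φ F K) (a : A.Obj X) :
    C.hom c (K.map a) = ⨆ (Y : Q) (b : B.Obj Y), Φ.app b a ≫ C.hom c (F.map b) := by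
  apply le_antisymm
  · have h : C.Le (K.map a) (hC.supObj (Φ.weightedSup (F.comp C.yoneda) a)) := by
      refine hK.le_hom_iff.mpr fun Y b => ?_
      rw [Category.id_comp]
      refine le_trans ?_ (hC.le_supObj _ (F.map b))
      refine le_iSup₂_of_le Y b ?_
      have h := comp_le_comp (le_refl (Φ.app b a)) (C.id_le (F.map b))
      rwa [Category.comp_id] at h
    exact (h.hom_le_hom c).trans ((hC.isTotallyCompact_iff c).mp hc _ _)
  · exact iSup₂_le fun Y b => (comp_le_comp (hK.le_hom b a) le_rfl).trans (C.comp_le _ _ _)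

/-- Colimits of presheaves are pointwise, and the component of the nerve at `b` is hom out of the
totally compact object `F.map b`. -/
theorem QFunctor.nerve_isCocontinuous (hA : A.IsCocomplete) (F : QFunctor B A)
    (hF : ∀ (X : Q) (b : B.Obj X), hA.IsTotallyCompact (F.map b)) : F.nerve.IsCocontinuous :=
  fun _ _ _ _ _ hK => isWeightedColimit_psh_iff.mpr fun _ a =>
    QCat.Presheaf.ext_pt fun Y b => (hF Y b).hom_colimit hK a

/-- By Yoneda, hom out of `C(-, c)` is evaluation at `c`, which commutes with the pointwise
supremum. Each `θ(c)` is again a hom-arrow `𝒫C(Yc, θ)`, absorbed by the action on `ξ`. -/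
theorem QCat.isTotallyCompact_representable (hC : C.psh.IsCocomplete) (c : C.Obj X) :
    hC.IsTotallyCompact (C.representable c : C.psh.Obj X) := by
  refine (hC.isTotallyCompact_iff _).mpr fun Y ξ => ?_
  refine (C.psh_hom_representable (hC.supObj ξ) c).le.trans ?_
  rw [QCat.psh_supObj_app]
  refine iSup₂_le fun Z θ => ?_
  rw [← QCat.psh_hom_representable θ c]
  exact Distributor.left_le ξ _ _ _

/-! ### Totally compact presheaves, adjoint distributors and Cauchy completeness. -/

/-- A distributor with a right adjoint consists of totally compact presheaves. -/
theorem Distributor.IsCauchy.isTotallyCompact (hC : C.psh.IsCocomplete) {Φ : Distributor A C}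
    (hΦ : Φ.IsCauchy) (a : A.Obj X) :
    hC.IsTotallyCompact ((A.delta a).graph.comp Φ : C.Presheaf X) := by
  obtain ⟨Ψ, h1, h2⟩ := hΦ
  have happ : ∀ {Y : Q} (c : C.Obj Y),
      ((A.delta a).graph.comp Φ : C.Presheaf X).app c (QCat.pt X) = Φ.app c a := fun {Y} c =>
    congrArg (fun Θ : Distributor A C => Θ.app c a) (Distributor.id_comp Φ)
  have h2' : ∀ {Y Z : Q} (c : C.Obj Y) (d : C.Obj Z), Ψ.app a d ≫ Φ.app c a ≤ C.hom c d :=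
    fun c d => (le_iSup₂ (f := fun Y (a : A.Obj Y) => Ψ.app a d ≫ Φ.app c a) X a).trans
      (h2 _ _ c d)
  have h1' : 𝟙 X ≤ ⨆ (Y : Q) (c : C.Obj Y), Φ.app c a ≫ Ψ.app a c := (A.id_le a).trans (h1 _ _ a a)
  refine (hC.isTotallyCompact_iff _).mpr fun Y ξ => ?_
  set φ : C.psh.Obj X := ((A.delta a).graph.comp Φ : C.Presheaf X)
  set k := C.psh.hom φ (hC.supObj ξ) with hk
  -- The unit of `Φ ⊣ Ψ` splits `k` into pieces passing through the objects `c`, where the supremum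
  -- of `ξ` can be evaluated pointwise.
  have h3 : k ≤ ⨆ (Y : Q) (c : C.Obj Y), k ≫ Φ.app c a ≫ Ψ.app a c := by
    have h := comp_le_comp (le_refl k) h1'
    rw [Category.comp_id] at h
    simpa only [comp_iSup] using h
  refine h3.trans (iSup₂_le fun Z c => ?_)
  have h4 := QCat.le_psh_hom.mp (le_refl k) Z c
  rw [happ, QCat.psh_supObj_app] at h4
  rw [← Category.assoc]
  refine (comp_le_comp h4 le_rfl).trans ?_
  simp only [iSup_comp, Category.assoc]
  -- The counit of `Φ ⊣ Ψ` shows that `θ(c)` followed by `Ψ(a, c)` lies below `𝒫C(φ, θ)`, and `ξ`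
  -- absorbs that arrow.
  refine iSup₂_le fun W θ => le_trans (comp_le_comp le_rfl ?_) (Distributor.left_le ξ φ θ _)
  refine QCat.le_psh_hom.mpr fun V d => ?_
  rw [happ, Category.assoc]
  exact (comp_le_comp le_rfl (h2' d c)).trans (Distributor.left_le θ _ _ _)

/-- A totally compact presheaf has a right adjoint. -/
theorem QCat.IsCocomplete.IsTotallyCompact.isCauchy {hC : C.psh.IsCocomplete} {φ : C.psh.Obj X}
    (hφ : hC.IsTotallyCompact φ) : Distributor.IsCauchy (A := QCat.star X) (B := C) φ := by
  -- A right adjoint of `φ` must be the lifting of the identity distributor through `φ`, whose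
  -- elements are `𝒫C(φ, Yc)`.
  refine ⟨
    { app := fun {W Z} p c => C.psh.hom ((C.psh.delta φ).map p) (C.yoneda.map c)
      left_le := fun p p' c =>
        (comp_le_comp le_rfl ((C.psh.delta φ).hom_le _ _)).trans (C.psh.comp_le _ _ _)
      right_le := fun p c' c =>
        (comp_le_comp (C.yoneda.hom_le _ _) le_rfl).trans (C.psh.comp_le _ _ _) }, ?_, ?_⟩
  · rintro _ _ ⟨⟩ ⟨⟩
    refine (C.psh.id_le φ).trans ?_
    -- The unit: `φ` is the colimit of representables weighted by itself, and hom out of `φ`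
    -- preserves this colimit.
    exact (hφ.hom_colimit (QCat.isWeightedColimit_yoneda φ) (QCat.pt X)).le
  · intro Y Z c' c
    refine iSup₂_le fun W p => ?_
    obtain ⟨⟩ := p
    exact QCat.le_psh_hom.mp (le_refl (C.psh.hom φ (C.yoneda.map c))) Z c'

/-- `C` is Cauchy complete precisely when its totally compact presheaves are representable. -/
theorem QCat.isCauchyComplete_iff (hC : C.psh.IsCocomplete) :
    C.IsCauchyComplete ↔ ∀ (X : Q) (φ : C.psh.Obj X), hC.IsTotallyCompact φ →
      ∃ c : C.Obj X, C.representable c = φ := by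
  constructor
  · intro h X φ hφ
    obtain ⟨F, hF⟩ := h _ _ hφ.isCauchy
    refine ⟨F.map (pt X), ?_⟩
    rw [← hF]
    exact QCat.Presheaf.ext_pt fun _ _ => rfl
  · intro h A Φ hΦ
    -- Each column `Φ(-, a)` is totally compact, hence representable; the representing objects form
    -- the desired functor.
    choose f hf using fun (X : Q) (a : A.Obj X) => h X _ (hΦ.isTotallyCompact hC a)
    have hf' : ∀ {X Y : Q} (a : A.Obj X) (c : C.Obj Y), C.hom c (f X a) = Φ.app c a :=
      fun {X Y} a c => (congrArg (fun φ : C.Presheaf X => φ.app c (pt X)) (hf X a)).trans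
        (congrArg (fun Θ : Distributor A C => Θ.app c a) (Distributor.id_comp Φ))
    refine ⟨⟨fun {X} a => f X a, fun {X Y} a' a => ?_⟩, Distributor.ext' fun X Y c a => hf' a c⟩
    rw [hf']
    refine le_trans ?_ (Φ.right_le _ a' _)
    rw [← hf']
    have h := comp_le_comp (le_refl (A.hom a' a)) (C.id_le (f Y a'))
    rwa [Category.comp_id] at h

/-- The corestricted Yoneda embedding `ℂ ⟶ (𝒫ℂ)_c`. -/
def QCat.corestrictedYoneda (C : QCat Q) (hC : C.psh.IsCocomplete) :
    QFunctor C (MapCocont.compacts ⟨C.psh, hC⟩) where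
  map {X} c := Subtype.mk (p := fun φ : C.psh.Obj X => hC.IsTotallyCompact φ)
    (C.representable c) (C.isTotallyCompact_representable hC c)
  hom_le c' c := C.yoneda.hom_le c' c

end Presheaves

/-! ### Realization of presheaves on the totally compact objects -/

namespace MapCocont

variable {Q : Type u} [Quantaloid Q] {A B : MapCocont Q} {C : QCat Q} {X Y Z : Q}

/-! ### The adjunction between realization and nerve. -/

/-- The functor `𝒫(𝔸_c) ⟶ 𝔸`, `φ ↦ colim(φ, i_𝔸)`. -/
noncomputable def realization (A : MapCocont Q) : QFunctor A.compacts.psh A.cat :=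
  A.incl.graph.tensor.comp A.isCocomplete.sup

/-- Realizing `F.graph ⊗ φ` gives the `φ`-weighted colimit of `F` followed by the inclusion. Taking
`F` to be the identity, the Yoneda embedding or a restricted left adjoint gives, respectively, the
universal property of realization, the left triangle and naturality of the counit. -/
theorem le_hom_realization_tensor {F : QFunctor C A.compacts} {φ : C.psh.Obj X} {x : A.cat.Obj Y}
    {h : Y ⟶ X} : h ≤ A.cat.hom (A.realization.map (F.graph.tensor.map φ)) x ↔
      ∀ (Z : Q) (c : C.Obj Z),
        h ≫ Distributor.app φ c (QCat.pt X) ≤ A.cat.hom (F.map c).1 x := by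
  have e : A.incl.graph.tensor.map (F.graph.tensor.map φ) =
      (F.comp A.incl).graph.tensor.map φ := by
    rw [QFunctor.tensor_graph_comp]
    rfl
  change h ≤ A.cat.hom
    (A.isCocomplete.supObj (A.incl.graph.tensor.map (F.graph.tensor.map φ))) x ↔ _
  rw [e]
  refine A.isCocomplete.le_hom_supObj.trans ⟨fun H Z c => ?_, fun H Z a => ?_⟩
  · refine le_trans (comp_le_comp le_rfl ?_) (H Z (F.map c).1)
    refine le_iSup₂_of_le Z c ?_
    have h := comp_le_comp (le_refl (Distributor.app φ c (QCat.pt X))) (A.cat.id_le (F.map c).1)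
    rwa [Category.comp_id] at h
  · simp only [Distributor.tensor, Distributor.comp, comp_iSup, ← Category.assoc]
    exact iSup₂_le fun W c => (comp_le_comp (H W c) le_rfl).trans (A.cat.comp_le _ _ _)

theorem le_hom_realization {φ : A.compacts.psh.Obj X} {x : A.cat.Obj Y} {h : Y ⟶ X} :
    h ≤ A.cat.hom (A.realization.map φ) x ↔ ∀ (Z : Q) (c : A.compacts.Obj Z),
      h ≫ Distributor.app φ c (QCat.pt X) ≤ A.cat.hom (A.incl.map c) x := by
  have e : (QFunctor.id A.compacts).graph.tensor.map φ = φ := Distributor.comp_id φ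
  conv_lhs => rw [← e]
  exact le_hom_realization_tensor

theorem isWeightedColimit_realization (φ : A.compacts.Presheaf X) :
    IsWeightedColimit φ A.incl (A.cat.delta (A.realization.map φ)) :=
  .of_le_hom_iff fun _ _ a _ _ => by
    obtain ⟨⟩ := a
    exact le_hom_realization

theorem realization_isAdjoint_nerve (A : MapCocont Q) :
    A.realization.IsAdjoint A.incl.nerve := by
  constructor
  · intro X φ
    refine QCat.psh_le.mpr fun Z c => ?_
    have h := le_hom_realization.mp (A.cat.id_le (A.realization.map φ)) Z c
    rwa [Category.id_comp] at h
  · exact fun X x => le_hom_realization.mpr fun Z c => (Category.id_comp _).le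

theorem nerve_incl_isCocontinuous (A : MapCocont Q) : A.incl.nerve.IsCocontinuous :=
  A.incl.nerve_isCocontinuous A.isCocomplete fun _ c => c.2

/-- Hom out of a compact `c` passes through the colimit and leaves `φ` composed with the identity
distributor of `𝔸_c`. Hence realization is fully faithful. -/
theorem nerve_realization (φ : A.compacts.psh.Obj X) :
    A.incl.nerve.map (A.realization.map φ) = φ := by
  refine QCat.Presheaf.ext_pt fun Y c => ?_
  refine (c.2.hom_colimit (isWeightedColimit_realization φ) (QCat.pt X)).trans ?_
  exact congrArg (fun Θ : A.compacts.Presheaf X => Θ.app c (QCat.pt X)) (Distributor.comp_id φ)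

/-- `𝔸` is totally algebraic precisely when every object is below the colimit of the totally
compact objects over it. -/
theorem isTotallyAlgebraic_iff :
    A.IsTotallyAlgebraic ↔ QFunctor.id A.cat ≤ A.incl.nerve.comp A.realization := by
  constructor
  · rintro ⟨L, hL, _, h⟩
    -- The universal property of `L` is tested on the composite of nerve and realization.
    refine h.trans ((hL _).mpr fun X c => ?_)
    have h := le_hom_realization.mp
      (A.cat.id_le (A.realization.map (A.incl.nerve.map (A.incl.map c)))) X c
    rw [Category.id_comp] at h
    exact (A.cat.id_le c.1).trans h
  · intro h
    refine ⟨QFunctor.id A.cat, fun K => ⟨fun hK X c => hK X c.1, fun hK X a => ?_⟩,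
      le_rfl, le_rfl⟩
    -- The object `a` is now the colimit of the compact objects over it, so it suffices that `𝔸(c,
    -- a) ≤ 𝔸(Kc, Ka) ≤ 𝔸(c, Ka)` for compact `c`.
    refine (h X a).trans (le_hom_realization.mpr fun Z c => ?_)
    rw [Category.id_comp]
    exact (K.hom_le c.1 a).trans (QCat.Le.hom_le_hom' (hK Z c) (K.map a))

/-- Representables are totally compact, and by co-Yoneda they already generate every presheaf. -/
theorem isTotallyAlgebraic_psh (hC : C.psh.IsCocomplete) :
    IsTotallyAlgebraic ⟨C.psh, hC⟩ := by
  refine isTotallyAlgebraic_iff.mpr fun X φ => QCat.le_psh_hom_yoneda.mpr fun Z c => ?_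
  rw [Category.id_comp]
  have h := le_hom_realization.mp (C.psh.id_le ((realization ⟨C.psh, hC⟩).map
    (QFunctor.map (incl ⟨C.psh, hC⟩).nerve φ))) Z
    (QFunctor.map (C.corestrictedYoneda hC) c)
  rw [Category.id_comp] at h
  exact (C.psh_hom_representable φ c).ge.trans h

theorem isCauchyComplete_compacts (A : MapCocont Q) : A.compacts.IsCauchyComplete := by
  refine (QCat.isCauchyComplete_iff A.compacts.psh_isCocomplete).mpr fun X φ hφ => ?_
  -- Realization has a cocontinuous right adjoint, so it preserves total compactness. The resulting
  -- object of `𝔸_c` represents its nerve, which is `φ`.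
  refine ⟨⟨A.realization.map φ, A.compacts.psh_isCocomplete.isTotallyCompact_map A.isCocomplete
    A.nerve_incl_isCocontinuous A.realization_isAdjoint_nerve hφ⟩, ?_⟩
  refine Eq.trans (QCat.Presheaf.ext_pt fun Y c => ?_) (nerve_realization φ)
  rfl

end MapCocont

/-! ### Equivalences in locally thin bicategories -/

section Thin

variable {B : Type u₁} [Bicategory.{w₁, v₁} B] {C : Type u₂} [Bicategory.{w₂, v₂} C]

/-- In a locally thin bicategory, mutually inverse 2-cells are all that an isomorphism needs. -/
def isoOfThin {a b : B} [Quiver.IsThin (a ⟶ b)] {f g : a ⟶ b} (η : f ⟶ g) (θ : g ⟶ f) : f ≅ g :=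
  ⟨η, θ, Subsingleton.elim _ _, Subsingleton.elim _ _⟩

/-- A mere inverse up to isomorphism suffices, since any equivalence can be improved to an adjoint
one. -/
theorem isEquivalenceHom_iff {a b : B} {f : a ⟶ b} :
    IsEquivalenceHom f ↔ ∃ g : b ⟶ a, Nonempty (f ≫ g ≅ 𝟙 a) ∧ Nonempty (g ≫ f ≅ 𝟙 b) := by
  constructor
  · rintro ⟨e, rfl⟩
    exact ⟨e.inv, ⟨e.unit.symm⟩, ⟨e.counit⟩⟩
  · rintro ⟨g, ⟨η⟩, ⟨κ⟩⟩
    exact ⟨Bicategory.Equivalence.mkOfAdjointifyCounit η.symm κ, rfl⟩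

theorem isEquivalence_of_thin {D : Type*} [Category D] {E : Type*} [Category E]
    [Quiver.IsThin D] [Quiver.IsThin E] (F : D ⥤ E)
    (full : ∀ {x y : D}, (F.obj x ⟶ F.obj y) → Nonempty (x ⟶ y))
    (surj : ∀ z : E, ∃ x, Nonempty (F.obj x ≅ z)) : F.IsEquivalence where
  faithful := ⟨fun _ => Subsingleton.elim _ _⟩
  full := ⟨fun θ => ⟨(full θ).some, Subsingleton.elim _ _⟩⟩
  essSurj := ⟨surj⟩

theorem FullSub.isEquivalenceHom {p : B → Prop} {a b : FullSub p} {f : a ⟶ b}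
    (hf : IsEquivalenceHom f.hom) : IsEquivalenceHom f := by
  obtain ⟨g, ⟨η⟩, ⟨κ⟩⟩ := isEquivalenceHom_iff.mp hf
  exact isEquivalenceHom_iff.mpr
    ⟨InducedBicategory.mkHom g, ⟨InducedBicategory.isoMk η⟩, ⟨InducedBicategory.isoMk κ⟩⟩

namespace Biadjunction

variable [∀ a b : B, Quiver.IsThin (a ⟶ b)] [∀ a b : C, Quiver.IsThin (a ⟶ b)]
  {F : Pseudofunctor B C} {G : Pseudofunctor C B} (β : Biadjunction F G)

/-- The equivalence `B(b, Gc) ≃ C(Fb, c)` of a biadjunction. -/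
theorem isEquivalence_homFunctor (b : B) (c : C) :
    (F.mapFunctor b (G.obj c) ⋙ postcomp (F.obj b) (β.counit.app c)).IsEquivalence := by
  -- Transposing `f` and then transposing back returns `f`, by naturality of the unit and the right
  -- triangle.
  have back : ∀ f : b ⟶ G.obj c,
      Nonempty (β.unit.app b ≫ G.map (F.map f ≫ β.counit.app c) ≅ f) := fun f =>
    ⟨whiskerLeftIso _ (G.mapComp _ _) ≪≫ (α_ _ _ _).symm ≪≫
      whiskerRightIso (β.unit.naturality f).symm _ ≪≫ α_ _ _ _ ≪≫
      whiskerLeftIso _ (β.right_triangle c) ≪≫ ρ_ _⟩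
  refine isEquivalence_of_thin _ (fun {f g} θ => ?_) fun h =>
    ⟨β.unit.app b ≫ G.map h, ⟨?_⟩⟩
  · exact ⟨(back f).some.inv ≫ β.unit.app b ◁ G.map₂ θ ≫ (back g).some.hom⟩
  · exact whiskerRightIso (F.mapComp _ _) _ ≪≫ α_ _ _ _ ≪≫
      whiskerLeftIso _ (β.counit.naturality h) ≪≫ (α_ _ _ _).symm ≪≫
      whiskerRightIso (β.left_triangle b) _ ≪≫ λ_ _

/-- The left biadjoint is a biequivalence when the unit and the counit are equivalences. -/
theorem isBiequivalence_left (hu : ∀ b, IsEquivalenceHom (β.unit.app b))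
    (hc : ∀ c, IsEquivalenceHom (β.counit.app c)) : IsBiequivalence F := by
  refine ⟨fun a b => ?_, fun c => ⟨G.obj c, ⟨(hc c).choose⟩⟩⟩
  obtain ⟨v, ⟨η⟩, ⟨κ⟩⟩ := isEquivalenceHom_iff.mp (hu b)
  have back : ∀ f : a ⟶ b, Nonempty (β.unit.app a ≫ G.map (F.map f) ≫ v ≅ f) := fun f =>
    ⟨(α_ _ _ _).symm ≪≫ whiskerRightIso (β.unit.naturality f).symm v ≪≫ α_ _ _ _ ≪≫
      whiskerLeftIso _ η ≪≫ ρ_ _⟩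
  refine isEquivalence_of_thin _ (fun {f g} θ => ?_) fun h => ⟨β.unit.app a ≫ G.map h ≫ v, ⟨?_⟩⟩
  · exact ⟨(back f).some.inv ≫ β.unit.app a ◁ G.map₂ θ ▷ v ≫ (back g).some.hom⟩
  -- By the left triangle the counit is left inverse to the image of the unit, so it agrees with the
  -- image of any inverse `v` of the unit.
  · have hv : F.map v ≅ β.counit.app (F.obj b) :=
      (ρ_ _).symm ≪≫ whiskerLeftIso _ (β.left_triangle b).symm ≪≫ (α_ _ _ _).symm ≪≫
        whiskerRightIso ((F.mapComp _ _).symm ≪≫ F.map₂Iso κ ≪≫ F.mapId _) _ ≪≫ λ_ _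
    exact F.mapComp _ _ ≪≫ whiskerLeftIso _ (F.mapComp _ _ ≪≫ whiskerLeftIso _ hv ≪≫
      β.counit.naturality h) ≪≫ (α_ _ _ _).symm ≪≫ whiskerRightIso (β.left_triangle a) _ ≪≫ λ_ _

/-- The right biadjoint is a biequivalence when the unit and the counit are equivalences. -/
theorem isBiequivalence_right (hu : ∀ b, IsEquivalenceHom (β.unit.app b))
    (hc : ∀ c, IsEquivalenceHom (β.counit.app c)) : IsBiequivalence G := by
  refine ⟨fun c d => ?_, fun b => ⟨F.obj b, ?_⟩⟩
  · obtain ⟨w, ⟨η⟩, ⟨κ⟩⟩ := isEquivalenceHom_iff.mp (hc c)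
    have back : ∀ h : c ⟶ d, Nonempty (w ≫ F.map (G.map h) ≫ β.counit.app d ≅ h) := fun h =>
      ⟨whiskerLeftIso _ (β.counit.naturality h) ≪≫ (α_ _ _ _).symm ≪≫ whiskerRightIso κ _ ≪≫ λ_ _⟩
    refine isEquivalence_of_thin _ (fun {h k} θ => ?_) fun f =>
      ⟨w ≫ F.map f ≫ β.counit.app d, ⟨?_⟩⟩
    · exact ⟨(back h).some.inv ≫ w ◁ F.map₂ θ ▷ β.counit.app d ≫ (back k).some.hom⟩
    -- Dually, the right triangle identifies the image of an inverse `w` of the counit with the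
    -- unit.
    · have hw : G.map w ≅ β.unit.app (G.obj c) :=
        (λ_ _).symm ≪≫ whiskerRightIso (β.right_triangle c).symm _ ≪≫ α_ _ _ _ ≪≫
          whiskerLeftIso _ ((G.mapComp _ _).symm ≪≫ G.map₂Iso η ≪≫ G.mapId _) ≪≫ ρ_ _
      exact G.mapComp _ _ ≪≫ whiskerRightIso hw _ ≪≫ whiskerLeftIso _ (G.mapComp _ _) ≪≫
        (α_ _ _ _).symm ≪≫ whiskerRightIso (β.unit.naturality f).symm _ ≪≫ α_ _ _ _ ≪≫
        whiskerLeftIso _ (β.right_triangle d) ≪≫ ρ_ _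
  · obtain ⟨v, ⟨η⟩, ⟨κ⟩⟩ := isEquivalenceHom_iff.mp (hu b)
    exact ⟨(isEquivalenceHom_iff.mpr ⟨β.unit.app b, ⟨κ⟩, ⟨η⟩⟩).choose⟩

end Biadjunction

end Thin

/-! ### The biadjunction -/

section Main

variable {Q : Type u} [Quantaloid Q]

/-- Isomorphism of functors from mutual inequalities. -/
def QCat.isoOfLe {A B : QCat Q} {F G : A ⟶ B}
    (h : ∀ (X : Q) (a : A.Obj X), B.Le (QFunctor.map F a) (QFunctor.map G a))
    (k : ∀ (X : Q) (a : A.Obj X), B.Le (QFunctor.map G a) (QFunctor.map F a)) : F ≅ G :=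
  isoOfThin (QCat.homOfLe h) (QCat.homOfLe k)

/-- Isomorphism of left adjoints from mutual inequalities of functors. -/
def MapCocont.isoOfLe {A B : MapCocont Q} {F G : A ⟶ B}
    (h : Hom.functor F ≤ Hom.functor G) (k : Hom.functor G ≤ Hom.functor F) : F ≅ G :=
  isoOfThin (homOfLe h) (homOfLe k)

/-- The corestricted Yoneda embedding as a 1-cell of `Cat(Q)`. -/
def QCat.yonedaHom (C : QCat Q) : C ⟶ (compactFunctor Q).obj ((presheafFunctor Q).obj C) :=
  C.corestrictedYoneda C.psh_isCocomplete

/-- The realization functor as a left adjoint in `Cocont(Q)`. -/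
noncomputable def MapCocont.realizationHom (A : MapCocont Q) :
    (presheafFunctor Q).obj ((compactFunctor Q).obj A) ⟶ A :=
  { functor := A.realization
    isCocontinuous := A.realization_isAdjoint_nerve.isCocontinuous
    exists_rightAdjoint := ⟨_, A.nerve_incl_isCocontinuous, A.realization_isAdjoint_nerve⟩ :
    MapCocont.Hom ⟨A.compacts.psh, A.compacts.psh_isCocomplete⟩ A }

theorem QFunctor.tensor_graph_representable {C D : QCat Q} (F : QFunctor C D) {X : Q}
    (c : C.Obj X) : F.graph.tensor.map (C.yoneda.map c) = D.yoneda.map (F.map c) :=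
  Eq.trans (QFunctor.graph_comp (C.delta c) F).symm (QCat.Presheaf.ext_pt fun _ _ => rfl)

/-- Realization is natural in left adjoints of `Cocont(Q)`. -/
theorem MapCocont.hom_map_realization {A B : MapCocont Q} (F : A ⟶ B) {X Y : Q}
    (φ : A.compacts.psh.Obj X) (x : B.cat.Obj Y) :
    B.cat.hom ((Hom.functor F).map (A.realization.map φ)) x =
      B.cat.hom (B.realization.map
        ((QFunctor.graph ((compactFunctor Q).map F)).tensor.map φ)) x := by
  -- Moving `F` across to `H` reduces both sides to the same condition on `φ` and the hom-arrows
  -- `𝔹(Fc, x)` for compact `c`.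
  obtain ⟨H, -, hF⟩ := Hom.exists_rightAdjoint F
  refine eq_of_forall_le_iff fun h => ?_
  rw [hF.hom_eq]
  refine le_hom_realization.trans (Iff.trans ?_ le_hom_realization_tensor.symm)
  exact forall₂_congr fun Z c => by rw [← hF.hom_eq]; rfl

/-- The realization of a representable presheaf represents the same object. -/
theorem MapCocont.hom_realization_representable {A : MapCocont Q} {X Y : Q} (c : A.compacts.Obj X)
    (x : A.cat.Obj Y) :
    A.cat.hom (A.realization.map (A.compacts.yoneda.map c)) x = A.cat.hom c.1 x := by
  rw [A.realization_isAdjoint_nerve.hom_eq]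
  exact A.compacts.psh_hom_representable _ c

/-- The biadjunction `𝒫 ⊣ (-)_c`. -/
noncomputable def presheafCompactBiadjunction (Q : Type u) [Quantaloid Q] :
    Biadjunction (presheafFunctor Q).toPseudofunctor (compactFunctor Q).toPseudofunctor where
  unit :=
    { app := fun C => C.yonedaHom
      naturality := fun {C D} F =>
        QCat.isoOfLe
          (fun X c => D.psh.le_of_eq (QFunctor.tensor_graph_representable F c).symm)
          (fun X c => D.psh.le_of_eq (QFunctor.tensor_graph_representable F c))
      naturality_naturality := fun _ => Subsingleton.elim _ _
      naturality_id := fun _ => Subsingleton.elim _ _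
      naturality_comp := fun _ _ => Subsingleton.elim _ _ }
  counit :=
    { app := fun A => A.realizationHom
      naturality := fun {A B} F => MapCocont.isoOfLe
        (fun X φ => QCat.le_of_forall_hom_le fun _ x => (MapCocont.hom_map_realization F φ x).le)
        (fun X φ => QCat.le_of_forall_hom_le fun _ x => (MapCocont.hom_map_realization F φ x).ge)
      naturality_naturality := fun _ => Subsingleton.elim _ _
      naturality_id := fun _ => Subsingleton.elim _ _
      naturality_comp := fun _ _ => Subsingleton.elim _ _ }
  left_triangle C := by
    -- After the universal property of realization is unfolded, this is the co-Yoneda lemma.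
    have key : ∀ (X Y : Q) (φ : C.psh.Obj X) (ψ : C.psh.Obj Y),
        C.psh.hom ((MapCocont.realization ⟨C.psh, C.psh_isCocomplete⟩).map
          ((QFunctor.graph C.yonedaHom).tensor.map φ)) ψ = C.psh.hom φ ψ :=
      fun X Y φ ψ => eq_of_forall_le_iff fun h =>
        (MapCocont.le_hom_realization_tensor (A := ⟨C.psh, C.psh_isCocomplete⟩)
          (F := C.corestrictedYoneda C.psh_isCocomplete)).trans QCat.le_psh_hom_yoneda.symm
    exact MapCocont.isoOfLe
      (fun X φ => QCat.le_of_forall_hom_le fun _ ψ => (key X _ φ ψ).ge)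
      (fun X φ => QCat.le_of_forall_hom_le fun _ ψ => (key X _ φ ψ).le)
  right_triangle A := QCat.isoOfLe
    (fun X c => QCat.le_of_forall_hom_le (A := A.cat) fun _ x =>
      (MapCocont.hom_realization_representable c x).ge)
    (fun X c => QCat.le_of_forall_hom_le (A := A.cat) fun _ x =>
      (MapCocont.hom_realization_representable c x).le)

/-! ### When the unit and the counit are equivalences. -/

theorem QCat.isEquivalenceHom_yonedaHom (C : QCat Q) :
    IsEquivalenceHom C.yonedaHom ↔ C.IsCauchyComplete := by
  rw [isEquivalenceHom_iff, QCat.isCauchyComplete_iff C.psh_isCocomplete]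
  constructor
  · rintro ⟨G, -, ⟨κ⟩⟩ X φ hφ
    -- The inverse gives a representable isomorphic to `φ`, and isomorphic presheaves are equal.
    exact ⟨QFunctor.map G ⟨φ, hφ⟩, QCat.psh_le_antisymm (QCat.leOfHom κ.hom X ⟨φ, hφ⟩)
      (QCat.leOfHom κ.inv X ⟨φ, hφ⟩)⟩
  · intro h
    choose g hg using h
    -- Full faithfulness of the Yoneda embedding makes the choice of representing objects
    -- functorial.
    have hg' : ∀ {X Y : Q} (φ : (MapCocont.compacts ⟨C.psh, C.psh_isCocomplete⟩).Obj X)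
        (ψ : (MapCocont.compacts ⟨C.psh, C.psh_isCocomplete⟩).Obj Y),
        C.hom (g X φ.1 φ.2) (g Y ψ.1 ψ.2) = C.psh.hom φ.1 ψ.1 := by
      intro X Y φ ψ
      rw [← C.psh_hom_yoneda_yoneda]
      exact congrArg₂ C.psh.hom (hg X φ.1 φ.2) (hg Y ψ.1 ψ.2)
    let G : (compactFunctor Q).obj ((presheafFunctor Q).obj C) ⟶ C :=
      (⟨fun {X} φ => g X φ.1 φ.2, fun φ ψ => (hg' φ ψ).ge⟩ :
        QFunctor (MapCocont.compacts ⟨C.psh, C.psh_isCocomplete⟩) C)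
    have hG : ∀ (X : Q) (φ : (MapCocont.compacts ⟨C.psh, C.psh_isCocomplete⟩).Obj X),
        C.representable (QFunctor.map G φ) = φ.1 := fun X φ => hg X φ.1 φ.2
    refine ⟨G, ⟨QCat.isoOfLe (fun X c => ?_) fun X c => ?_⟩,
      ⟨QCat.isoOfLe (fun X φ => ?_) fun X φ => ?_⟩⟩
    · refine (C.psh.id_le (C.yoneda.map c)).trans (Eq.le ?_)
      refine Eq.trans ?_ (C.psh_hom_yoneda_yoneda _ c)
      exact congrArg (fun θ => C.psh.hom θ (C.yoneda.map c))
        (hG X (QFunctor.map C.yonedaHom c)).symm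
    · refine (C.psh.id_le (C.yoneda.map c)).trans (Eq.le ?_)
      refine Eq.trans ?_ (C.psh_hom_yoneda_yoneda c _)
      exact congrArg (C.psh.hom (C.yoneda.map c)) (hG X (QFunctor.map C.yonedaHom c)).symm
    · exact (C.psh.id_le φ.1).trans
        (congrArg (fun θ => C.psh.hom θ φ.1) (hG X φ).symm).le
    · exact (C.psh.id_le φ.1).trans (congrArg (C.psh.hom φ.1) (hG X φ).symm).le

theorem MapCocont.isEquivalenceHom_realizationHom (A : MapCocont Q) :
    IsEquivalenceHom A.realizationHom ↔ A.IsTotallyAlgebraic := by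
  rw [isEquivalenceHom_iff, isTotallyAlgebraic_iff]
  constructor
  · rintro ⟨G, -, ⟨κ⟩⟩ X a
    have h1 : A.cat.Le a (A.realization.map ((Hom.functor G).map a)) := leOfHom κ.inv X a
    have h2 : A.cat.Le (A.realization.map ((Hom.functor G).map a)) a := leOfHom κ.hom X a
    -- Any inverse `G` lies below the nerve, since `Ga ≤ nerve (R (Ga)) ≤ nerve a`. Hence `a ≤ R
    -- (Ga) ≤ R (nerve a)`.
    have h3 : A.compacts.psh.Le ((Hom.functor G).map a) (A.incl.nerve.map a) :=
      (A.realization_isAdjoint_nerve.1 X _).trans (le_trans h2 (A.incl.nerve.hom_le _ _))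
    exact h1.trans (le_trans h3 (A.realization.hom_le _ _))
  · intro h
    -- The inverse is the nerve. Under `h` it is also left adjoint to realization, so it is a 1-cell
    -- of `Map(Cocont(Q))`.
    let G : A ⟶ (presheafFunctor Q).obj ((compactFunctor Q).obj A) :=
      ({ functor := A.incl.nerve
         isCocontinuous := A.nerve_incl_isCocontinuous
         exists_rightAdjoint := ⟨A.realization, A.realization_isAdjoint_nerve.isCocontinuous, h,
          fun X φ => QCat.le_of_eq (nerve_realization φ)⟩ } :
        Hom A ⟨A.compacts.psh, A.compacts.psh_isCocomplete⟩)
    exact ⟨G, ⟨isoOfLe (fun X φ => QCat.le_of_eq (nerve_realization φ))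
      A.realization_isAdjoint_nerve.1⟩, ⟨isoOfLe A.realization_isAdjoint_nerve.2 h⟩⟩

end Main

theorem theoremA7 (Q : Type u) [Quantaloid Q] :
    ∃ β : Biadjunction (presheafFunctor Q).toPseudofunctor (compactFunctor Q).toPseudofunctor,
      (∀ (C : QCat Q) (X : Q) (x : C.Obj X),
        (QFunctor.map (β.unit.app C) x).1 = C.representable x) ∧
      (∀ (A : MapCocont Q) (X : Q) (φ : A.compacts.Presheaf X),
        IsWeightedColimit φ A.incl
          (A.cat.delta ((MapCocont.Hom.functor (β.counit.app A)).map φ))) ∧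
      (∀ (C : QCat Q) (A : MapCocont Q),
        ((presheafFunctor Q).mapFunctor C A.compacts ⋙
          postcomp ((presheafFunctor Q).obj C) (β.counit.app A)).IsEquivalence) ∧
      (∀ C : QCat Q, IsEquivalenceHom (β.unit.app C) ↔ C.IsCauchyComplete) ∧
      (∀ A : MapCocont Q, IsEquivalenceHom (β.counit.app A) ↔ A.IsTotallyAlgebraic) ∧
      ∃ (hP : ∀ C : QCat Q, C.IsCauchyComplete → ((presheafFunctor Q).obj C).IsTotallyAlgebraic)
        (hc : ∀ A : MapCocont Q, A.IsTotallyAlgebraic →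
          ((compactFunctor Q).obj A).IsCauchyComplete),
        (∀ C, IsEquivalenceHom ((β.restrict hP hc).unit.app C)) ∧
        (∀ A, IsEquivalenceHom ((β.restrict hP hc).counit.app A)) ∧
        IsBiequivalence (restrictFunctor (presheafFunctor Q) hP).toPseudofunctor ∧
        IsBiequivalence (restrictFunctor (compactFunctor Q) hc).toPseudofunctor := by
  have hP : ∀ C : QCat Q, C.IsCauchyComplete → ((presheafFunctor Q).obj C).IsTotallyAlgebraic :=
    fun C _ => MapCocont.isTotallyAlgebraic_psh C.psh_isCocomplete
  have hc : ∀ A : MapCocont Q, A.IsTotallyAlgebraic →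
      ((compactFunctor Q).obj A).IsCauchyComplete := fun A _ => A.isCauchyComplete_compacts
  -- The restricted unit and counit keep their components, and membership in the full subcategories
  -- is exactly the criterion for these to be equivalences.
  have hu : ∀ C, IsEquivalenceHom
      (((presheafCompactBiadjunction Q).restrict hP hc).unit.app C) := fun C =>
    FullSub.isEquivalenceHom ((QCat.isEquivalenceHom_yonedaHom C.1).mpr C.2)
  have hr : ∀ A, IsEquivalenceHom
      (((presheafCompactBiadjunction Q).restrict hP hc).counit.app A) := fun A =>
    FullSub.isEquivalenceHom (A.1.isEquivalenceHom_realizationHom.mpr A.2)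
  exact ⟨presheafCompactBiadjunction Q, fun _ _ _ => rfl,
    fun _ _ φ => MapCocont.isWeightedColimit_realization φ,
    fun C A => (presheafCompactBiadjunction Q).isEquivalence_homFunctor C A,
    QCat.isEquivalenceHom_yonedaHom, MapCocont.isEquivalenceHom_realizationHom,
    hP, hc, hu, hr, Biadjunction.isBiequivalence_left _ hu hr,
    Biadjunction.isBiequivalence_right _ hu hr⟩
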